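/- For $\tau$ in the upper half plane put $q=e^{2\pi i\tau}$, and write $(a;q)_\infty=\prod_{k\ge 0}(1-aq^k)$ and $(a_1,\dots,a_r;q)_\infty=\prod_{j=1}^r(a_j;q)_\infty$. For a Dirichlet character $\chi$ modulo $p$ with $\chi(-1)=-1$ let $$E_{\chi,1}(\tau)=1+\frac{2}{L(0,\chi)}\sum_{n=1}^{\infty}\chi(n)\frac{q^n}{1-q^n},$$ where $L(s,\chi)$ denotes the analytic continuation of the Dirichlet $L$-series. For each prime $5\le p\le 19$ let $$\mathcal{E}_p(\tau)=\frac{2}{p-1}\sum_{\chi}E_{\chi,1}(\tau),$$ the sum being over the odd primitive Dirichlet characters $\chi$ modulo $p$. Then, for every $\tau$ in the upper half plane, \begin{align*} \mathcal{E}_{5}(\tau) &= \frac{(q;q)_{\infty}^{2}}{(q,q^{4};q^{5})_{\infty}^{5}}, & \mathcal{E}_{7}(\tau) &= \frac{(q^{3},q^{4},q^{7},q^{7};q^{7})_{\infty}}{(q,q^{6};q^{7})_{\infty}^{2}},\\ \mathcal{E}_{11}(\tau) &= \frac{(q^{4},q^{7},q^{11},q^{11};q^{11})_{\infty}}{(q,q^{10},q^{2},q^{9};q^{11})_{\infty}},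 & \mathcal{E}_{13}(\tau) &= \frac{(q^{6},q^{7},q^{13},q^{13};q^{13})_{\infty}}{(q,q^{12},q^{3},q^{10};q^{13})_{\infty}},\\ \mathcal{E}_{17}(\tau) &= \frac{(q^{8},q^{9},q^{17},q^{17};q^{17})_{\infty}}{(q^{2},q^{15},q^{3},q^{14};q^{17})_{\infty}}, & \mathcal{E}_{19}(\tau) &= \frac{(q^{8},q^{11},q^{9},q^{10},q^{19},q^{19};q^{19})_{\infty}}{(q^{3},q^{16},q^{4},q^{15},q^{5},q^{14};q^{19})_{\infty}}. \end{align*} -/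

import Mathlib

open scoped UpperHalfPlane

noncomputable section

namespace WeightOneEisenstein

/-- The nome `q = exp (2 π i τ)` of a point `τ` of the upper half plane. -/
def nome (τ : ℍ) : ℂ := Complex.exp (2 * Real.pi * Complex.I * (τ : ℂ))

/-- The infinite `q`-Pochhammer symbol `(a; q)_∞ = ∏_{k ≥ 0} (1 - a q ^ k)`. -/
def qPoch (a q : ℂ) : ℂ := ∏' k : ℕ, (1 - a * q ^ k)

/-- The multiple symbol `(a₁, …, aᵣ; q)_∞ = (a₁; q)_∞ ⋯ (aᵣ; q)_∞`. -/
def qPochs (l : List ℂ) (q : ℂ) : ℂ := (l.map fun a => qPoch a q).prod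

/-- The Hecke Eisenstein series of weight `k` twisted by a Dirichlet character `χ` modulo `N`,
`E_{χ,k}(τ) = 1 + 2 / L(1 - k, χ) * ∑_{n ≥ 1} χ(n) n ^ (k - 1) q ^ n / (1 - q ^ n)`,
where `L(s, χ)` is the analytic continuation of the Dirichlet `L`-series. The weight `k` is a
positive integer. -/
def eisenstein {N : ℕ} [NeZero N] (χ : DirichletCharacter ℂ N) (k : ℕ) (τ : ℍ) : ℂ :=
  1 + 2 / χ.LFunction (1 - (k : ℂ)) *
    ∑' n : ℕ+, χ ((n : ℕ) : ZMod N) *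
      (((n : ℕ) : ℂ) ^ (k - 1) * nome τ ^ (n : ℕ) / (1 - nome τ ^ (n : ℕ)))

open scoped Classical in
/-- The normalized sum of the weight-one Eisenstein series over the odd primitive Dirichlet
characters modulo `p`, `(2 / (p - 1)) * ∑ E_{χ,1}(τ)`. -/
def eisensteinSum (p : ℕ) [NeZero p] (τ : ℍ) : ℂ :=
  2 / ((p : ℂ) - 1) *
    ∑ χ : DirichletCharacter ℂ p with χ.Odd ∧ χ.IsPrimitive, eisenstein χ 1 τ

/-! The following facts show that the infinite products and series above converge and that the
value `L(0, χ)` in the denominators does not vanish. -/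

theorem norm_nome_lt_one (τ : ℍ) : ‖nome τ‖ < 1 := by
  have h := UpperHalfPlane.norm_exp_two_pi_I_lt_one τ
  simpa [nome, mul_assoc] using h

theorem multipliable_qPoch (a : ℂ) {q : ℂ} (hq : ‖q‖ < 1) :
    Multipliable fun k : ℕ => 1 - a * q ^ k := by
  have h : Summable fun k : ℕ => ‖-(a * q ^ k)‖ := by
    simpa [norm_mul, norm_pow] using
      (summable_geometric_of_lt_one (norm_nonneg q) hq).mul_left ‖a‖
  simpa [sub_eq_add_neg] using multipliable_one_add_of_summable h

theorem summable_eisenstein {N : ℕ} [NeZero N] (χ : DirichletCharacter ℂ N) (k : ℕ) (τ : ℍ) :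
    Summable fun n : ℕ+ => χ ((n : ℕ) : ZMod N) *
      (((n : ℕ) : ℂ) ^ (k - 1) * nome τ ^ (n : ℕ) / (1 - nome τ ^ (n : ℕ))) := by
  have h := (summable_norm_pow_mul_geometric_div_one_sub (k - 1)
    (norm_nome_lt_one τ)).comp_injective PNat.coe_injective
  have h' := h.norm
  refine Summable.of_norm_bounded h' fun n => ?_
  rw [norm_mul]
  exact mul_le_of_le_one_left (norm_nonneg _) (χ.norm_le_one _)

theorem LFunction_zero_ne_zero {N : ℕ} [NeZero N] (χ : DirichletCharacter ℂ N)
    (hodd : χ.Odd) (hprim : χ.IsPrimitive) : χ.LFunction (1 - ((1 : ℕ) : ℂ)) ≠ 0 := by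
  have hinv : χ⁻¹.IsPrimitive := by
    rw [DirichletCharacter.IsPrimitive, DirichletCharacter.conductor_inv]
    exact hprim
  have hne : χ ≠ 1 := by
    rintro rfl
    have h : (1 : DirichletCharacter ℂ N) (-1) = -1 := hodd
    rw [MulChar.one_apply (isUnit_one.neg)] at h
    norm_num at h
  have hN : N ≠ 1 := fun h => hne (DirichletCharacter.level_one' χ h)
  have h1 := DirichletCharacter.LFunction_apply_one_ne_zero (inv_ne_one.mpr hne)
  have hfe := hinv.completedLFunction_one_sub 0
  intro h0
  rw [DirichletCharacter.LFunction_eq_completed_div_gammaFactor _ _ (Or.inr hN),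
    hodd.gammaFactor_def, div_eq_zero_iff] at h0
  rcases h0 with h0 | h0
  · apply h1
    rw [DirichletCharacter.LFunction_eq_completed_div_gammaFactor _ _ (Or.inr hN)]
    have hz : χ.completedLFunction 0 = 0 := by simpa using h0
    rw [inv_inv, hz, mul_zero, sub_zero] at hfe
    rw [hfe, zero_div]
  · exact Complex.Gammaℝ_ne_zero_of_re_pos (by norm_num) h0

end WeightOneEisenstein

end

open scoped UpperHalfPlane

noncomputable section

namespace WeightOneEisenstein

open Filter Topology

/-! ### Lambert series and the Kronecker series -/

/-! The proof joins an arithmetic fact about L(0,χ) to a theta function identity. Write Λ(x) for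
`lambert Q x`, ⟨r⟩ for the least nonnegative residue mod p and θ(z) for `theta Q z`.

Arithmetic: for odd χ mod p, L(0,χ) = -(1/p) Σ χ(j)⟨j⟩. For each of the six primes there is a triple
(a,b,c) such that ⟨am⟩ + ⟨bm⟩ + ⟨cm⟩ - ⟨(a+b+c)m⟩ has odd part -p([m=1] - [m=-1]), a finite check.
Summing against χ makes 2/L(0,χ) a signed sum of four character values (`two_div_LFunction_zero`),
and orthogonality over the odd characters turns the averaged Eisenstein series into 1 + Λ(q^a) +
Λ(q^b) + Λ(q^c) - Λ(q^(a+b+c)) with Q = q^p (`eisensteinSum_eq_lambertClass`,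
`lambert_eq_lambertClass`).

Analysis: 1 + Λ(x) + Λ(y) + Λ(w) - Λ(xyw) is a quotient of theta products
(`theta_product_eq_lambert`). Indeed Kronecker's series F(a,w) equals (Q;Q)²θ(aw)/(θ(a)θ(w))
(`kronecker_mul_theta`), and F(x,w)F(y,w) is F(xy,w) times that Lambert combination
(`kronecker_mul_kronecker`). Both come from comparing Laurent coefficients in w on the annulus |Q| <
|w| < 1; no modular forms enter. Common theta factors then cancel through θ(q^k) = θ(q^(p-k)). -/

/-- The terms of the bilateral Lambert series: `x Q ^ i / (1 - x Q ^ i)` for `0 ≤ i`, and the same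
expression increased by one for `i < 0`. -/
def lambertTerm (Q x : ℂ) (i : ℤ) : ℂ :=
  if 0 ≤ i then x * Q ^ i / (1 - x * Q ^ i) else 1 / (1 - x * Q ^ i)

/-- The regularized bilateral Lambert series `∑ x Q ^ i / (1 - x Q ^ i)`. -/
def lambert (Q x : ℂ) : ℂ := ∑' i : ℤ, lambertTerm Q x i

/-- Kronecker's series `∑ w ^ n / (1 - a Q ^ n)`, summed over all integers. -/
def kronecker (Q a w : ℂ) : ℂ := ∑' n : ℤ, w ^ n / (1 - a * Q ^ n)

theorem summable_norm_pow_mul_of_tendsto {r l : ℂ} (hr : ‖r‖ < 1) {g : ℕ → ℂ}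
    (hg : Tendsto g atTop (𝓝 l)) : Summable fun n : ℕ => ‖r ^ n * g n‖ := by
  obtain ⟨C, hC⟩ := hg.norm.bddAbove_range
  refine Summable.of_nonneg_of_le (fun _ => norm_nonneg _) (fun n => ?_)
    ((summable_geometric_of_lt_one (norm_nonneg r) hr).mul_right C)
  rw [norm_mul, norm_pow]
  exact mul_le_mul_of_nonneg_left (hC ⟨n, rfl⟩) (by positivity)

/-- At i = -(k+1) the added 1 turns a term tending to -1 into a geometrically small one in
Q^(k+1)/x. For Q = q^p and x = q^k these negative indices become the residue class of -k. -/
theorem hasSum_lambertTerm {Q x : ℂ} (hQ0 : Q ≠ 0) (hQ : ‖Q‖ < 1) (hx0 : x ≠ 0)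
    (hx : ∀ n : ℤ, 1 - x * Q ^ n ≠ 0) :
    HasSum (lambertTerm Q x) ((∑' k : ℕ, x * Q ^ k / (1 - x * Q ^ k)) -
      ∑' k : ℕ, Q ^ (k + 1) / x / (1 - Q ^ (k + 1) / x)) := by
  have hpow : Tendsto (fun n : ℕ => Q ^ n) atTop (𝓝 0) := tendsto_pow_atTop_nhds_zero_of_norm_lt_one hQ
  have h1 : Summable fun k : ℕ => x * Q ^ k / (1 - x * Q ^ k) := by
    have hg : Tendsto (fun k : ℕ => x / (1 - x * Q ^ k)) atTop (𝓝 (x / (1 - x * 0))) :=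
      tendsto_const_nhds.div (tendsto_const_nhds.sub (hpow.const_mul x)) (by simp)
    refine (summable_norm_pow_mul_of_tendsto hQ hg).of_norm.congr fun k => ?_
    ring
  have h2 : Summable fun k : ℕ => Q ^ (k + 1) / x / (1 - Q ^ (k + 1) / x) := by
    have hg : Tendsto (fun k : ℕ => Q / x / (1 - Q / x * Q ^ k)) atTop
        (𝓝 (Q / x / (1 - Q / x * 0))) :=
      tendsto_const_nhds.div (tendsto_const_nhds.sub (hpow.const_mul _)) (by simp)
    refine (summable_norm_pow_mul_of_tendsto hQ hg).of_norm.congr fun k => ?_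
    rw [pow_succ]
    ring
  have h := HasSum.of_nat_of_neg_add_one (f := lambertTerm Q x) (m := _) (m' := _)
    (h1.hasSum.congr_fun fun k => ?_) (h2.hasSum.neg.congr_fun fun k => ?_)
  · rw [sub_eq_add_neg]
    exact h
  · simp [lambertTerm]
  · have hk := hx (-((k : ℤ) + 1))
    have hz : x * Q ^ (-((k : ℤ) + 1)) = x / Q ^ (k + 1) := by
      rw [zpow_neg, div_eq_mul_inv]
      norm_cast
    rw [hz] at hk
    have hQk : Q ^ (k + 1) ≠ 0 := pow_ne_zero _ hQ0
    have hne : Q ^ (k + 1) - x ≠ 0 := by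
      intro h
      apply hk
      rw [sub_eq_zero] at h
      rw [← h, div_self hQk, sub_self]
    have hne' : x - Q ^ (k + 1) ≠ 0 := by
      rw [← neg_sub]
      exact neg_ne_zero.mpr hne
    rw [lambertTerm, if_neg (by lia), hz]
    field_simp
    rw [← neg_sub]

/-- The terms decay like w^n for n ≥ 0 and like (Q/w)^k for n = -(k+1), which is why w lies in the
annulus. -/
theorem summable_norm_kronecker {Q a w : ℂ} (hQ0 : Q ≠ 0) (hQ : ‖Q‖ < 1) (ha0 : a ≠ 0)
    (ha : ∀ n : ℤ, 1 - a * Q ^ n ≠ 0) (hQw : ‖Q‖ < ‖w‖) (hw : ‖w‖ < 1) :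
    Summable fun n : ℤ => ‖w ^ n / (1 - a * Q ^ n)‖ := by
  have hpow : Tendsto (fun n : ℕ => Q ^ n) atTop (𝓝 0) := tendsto_pow_atTop_nhds_zero_of_norm_lt_one hQ
  have hw0 : w ≠ 0 := norm_pos_iff.mp ((norm_nonneg Q).trans_lt hQw)
  refine Summable.of_nat_of_neg_add_one ?_ ?_
  · have hg : Tendsto (fun k : ℕ => 1 / (1 - a * Q ^ k)) atTop (𝓝 (1 / (1 - a * 0))) :=
      tendsto_const_nhds.div (tendsto_const_nhds.sub (hpow.const_mul a)) (by simp)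
    refine (summable_norm_pow_mul_of_tendsto hw hg).congr fun k => ?_
    simp [div_eq_mul_inv]
  · have hg : Tendsto (fun k : ℕ => Q / w / (Q * Q ^ k - a)) atTop (𝓝 (Q / w / (Q * 0 - a))) :=
      tendsto_const_nhds.div ((hpow.const_mul Q).sub tendsto_const_nhds) (by simpa using ha0)
    have hr : ‖Q / w‖ < 1 := by
      rw [norm_div]
      exact (div_lt_one (norm_pos_iff.mpr hw0)).mpr hQw
    refine (summable_norm_pow_mul_of_tendsto hr hg).congr fun k => ?_
    congr 1
    have h1 : Q ^ (-((k : ℤ) + 1)) = (Q ^ (k + 1))⁻¹ := by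
      rw [zpow_neg]; norm_cast
    have h2 : w ^ (-((k : ℤ) + 1)) = (w ^ (k + 1))⁻¹ := by
      rw [zpow_neg]; norm_cast
    have hk := ha (-((k : ℤ) + 1))
    rw [h1] at hk
    have hQk : Q ^ (k + 1) ≠ 0 := pow_ne_zero _ hQ0
    rw [h1, h2]
    have hne : Q ^ (k + 1) - a ≠ 0 := by
      intro h
      apply hk
      rw [sub_eq_zero] at h
      rw [← h, mul_inv_cancel₀ hQk, sub_self]
    have hd : 1 - a * (Q ^ (k + 1))⁻¹ = (Q ^ (k + 1) - a) / Q ^ (k + 1) := by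
      field_simp
    rw [hd, ← pow_succ', pow_succ]
    rw [pow_succ'] at hne
    rw [div_pow, pow_succ' w]
    field_simp

/-- Product of two series, collected along the fibers of `(n, i) ↦ n - s i`. -/
theorem hasSum_mul_of_hasSum_fiber {ι : Type*} {f c : ℤ → ℂ} {g : ι → ℂ} (s : ι → ℤ)
    (hf : Summable fun n => ‖f n‖) (hg : Summable fun i => ‖g i‖)
    (hc : ∀ n, HasSum (fun i => f (n - s i) * g i) (c n)) :
    HasSum c ((∑' n, f n) * ∑' i, g i) := by
  let e : ℤ × ι ≃ ℤ × ι :=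
    { toFun := fun x => (x.1 - s x.2, x.2)
      invFun := fun x => (x.1 + s x.2, x.2)
      left_inv := fun x => by simp
      right_inv := fun x => by simp }
  have h := (summable_mul_of_summable_norm hf hg).hasSum
  rw [← tsum_mul_tsum_of_summable_norm hf hg, ← e.hasSum_iff] at h
  exact h.prod_fiberwise hc

/-- Partial fractions: in the convolution of two Kronecker series, A B = x y Q^n does not depend on
the summation index. -/
theorem one_add_div_add_div {A B : ℂ} (hA : 1 - A ≠ 0) (hB : 1 - B ≠ 0) :
    1 + A / (1 - A) + B / (1 - B) = (1 - A * B) * (1 / (1 - A) * (1 / (1 - B))) := by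
  field_simp
  ring

theorem lambertTerm_eq {Q x : ℂ} (hx : ∀ n : ℤ, 1 - x * Q ^ n ≠ 0) (i : ℤ) :
    lambertTerm Q x i = x * Q ^ i / (1 - x * Q ^ i) + if 0 ≤ i then 0 else 1 := by
  have h := hx i
  rw [lambertTerm]
  split_ifs
  · simp
  · field_simp
    ring

/-- The net effect of the regularizing constants at i and n - i: the summand is 1 on [0, n] when n ≥
0, and -1 on (n, 0) when n < 0. -/
theorem hasSum_ite_sub_ite (n : ℤ) :
    HasSum (fun i : ℤ => 1 - (if 0 ≤ i then (0 : ℂ) else 1) - if 0 ≤ n - i then 0 else 1)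
      (n + 1) := by
  rcases le_or_gt 0 n with hn | hn
  · have h : HasSum (fun i : ℤ => if i ∈ Finset.Icc 0 n then (1 : ℂ) else 0)
        (∑ i ∈ Finset.Icc 0 n, if i ∈ Finset.Icc 0 n then (1 : ℂ) else 0) :=
      hasSum_sum_of_ne_finset_zero fun i hi => if_neg hi
    have hs : (∑ i ∈ Finset.Icc 0 n, if i ∈ Finset.Icc 0 n then (1 : ℂ) else 0) = n + 1 := by
      rw [Finset.sum_ite_mem, Finset.inter_self, Finset.sum_const, Int.card_Icc, sub_zero,
        nsmul_one, ← Int.cast_natCast, Int.toNat_of_nonneg (by lia)]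
      push_cast
      ring
    rw [hs] at h
    refine h.congr_fun fun i => ?_
    simp only [Finset.mem_Icc]
    split_ifs <;> first | lia | simp
  · have h : HasSum (fun i : ℤ => if i ∈ Finset.Ioo n 0 then (-1 : ℂ) else 0)
        (∑ i ∈ Finset.Ioo n 0, if i ∈ Finset.Ioo n 0 then (-1 : ℂ) else 0) :=
      hasSum_sum_of_ne_finset_zero fun i hi => if_neg hi
    have hs : (∑ i ∈ Finset.Ioo n 0, if i ∈ Finset.Ioo n 0 then (-1 : ℂ) else 0) = n + 1 := by
      rw [Finset.sum_ite_mem, Finset.inter_self, Finset.sum_const, Int.card_Ioo, smul_neg,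
        nsmul_one, ← Int.cast_natCast, Int.toNat_of_nonneg (by lia)]
      push_cast
      ring
    rw [hs] at h
    refine h.congr_fun fun i => ?_
    simp only [Finset.mem_Ioo]
    split_ifs <;> first | lia | simp

theorem summable_lambertTerm {Q x : ℂ} (hQ0 : Q ≠ 0) (hQ : ‖Q‖ < 1) (hx0 : x ≠ 0)
    (hx : ∀ n : ℤ, 1 - x * Q ^ n ≠ 0) : Summable (lambertTerm Q x) :=
  (hasSum_lambertTerm hQ0 hQ hx0 hx).summable

/-- The coefficient of w^n in the product is Σ 1/((1 - xQ^(n-i))(1 - yQ^i)); partial fractions split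
it into two Lambert series plus the count n + 1. -/
theorem hasSum_convolution_kronecker {Q x y w : ℂ} (hQ0 : Q ≠ 0) (hQ : ‖Q‖ < 1) (hx0 : x ≠ 0)
    (hx : ∀ n : ℤ, 1 - x * Q ^ n ≠ 0) (hy0 : y ≠ 0) (hy : ∀ n : ℤ, 1 - y * Q ^ n ≠ 0)
    (hxy : ∀ n : ℤ, 1 - x * y * Q ^ n ≠ 0) (hQw : ‖Q‖ < ‖w‖) (hw : ‖w‖ < 1) :
    HasSum (fun n : ℤ => (n + 1 + lambert Q x + lambert Q y) * (w ^ n / (1 - x * y * Q ^ n)))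
      (kronecker Q x w * kronecker Q y w) := by
  have hw0 : w ≠ 0 := norm_pos_iff.mp ((norm_nonneg Q).trans_lt hQw)
  refine hasSum_mul_of_hasSum_fiber (fun i : ℤ => i) (summable_norm_kronecker hQ0 hQ hx0 hx hQw hw)
    (summable_norm_kronecker hQ0 hQ hy0 hy hQw hw) fun n => ?_
  have hSx := ((Equiv.subLeft n).hasSum_iff.mpr (summable_lambertTerm hQ0 hQ hx0 hx).hasSum)
  have hSy := (summable_lambertTerm hQ0 hQ hy0 hy).hasSum
  have h := (((hasSum_ite_sub_ite n).add hSx).add hSy).mul_right (w ^ n / (1 - x * y * Q ^ n))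
  refine h.congr_fun fun i => ?_
  simp only [Function.comp_apply, Equiv.subLeft_apply]
  rw [lambertTerm_eq hx, lambertTerm_eq hy]
  have hAB : x * Q ^ (n - i) * (y * Q ^ i) = x * y * Q ^ n := by
    rw [zpow_sub₀ hQ0]
    have := zpow_ne_zero i hQ0
    field_simp
  have hid := one_add_div_add_div (hx (n - i)) (hy i)
  rw [hAB] at hid
  have hn := hxy n
  have hwn : w ^ (n - i) * w ^ i = w ^ n := by
    rw [← zpow_add₀ hw0]; simp
  calc _ = w ^ (n - i) * w ^ i * (1 / (1 - x * Q ^ (n - i)) * (1 / (1 - y * Q ^ i))) := by ring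
    _ = (1 - x * y * Q ^ n) * (1 / (1 - x * Q ^ (n - i)) * (1 / (1 - y * Q ^ i))) *
        (w ^ n / (1 - x * y * Q ^ n)) := by
      rw [hwn]
      field_simp
    _ = _ := by
      rw [← hid]
      ring

/-- Since A/(1-A) + A⁻¹/(1-A⁻¹) = -1, the terms at i and -i cancel against the one regularizing 1;
at i = 0 no such 1 is present. -/
theorem lambert_inv {Q w : ℂ} (hQ0 : Q ≠ 0) (hQ : ‖Q‖ < 1) (hw0 : w ≠ 0)
    (hw : ∀ n : ℤ, 1 - w * Q ^ n ≠ 0) (hw' : ∀ n : ℤ, 1 - w⁻¹ * Q ^ n ≠ 0) :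
    lambert Q w⁻¹ = -1 - lambert Q w := by
  have h1 := ((Equiv.neg ℤ).hasSum_iff.mpr
    (summable_lambertTerm hQ0 hQ (inv_ne_zero hw0) hw').hasSum).add
      (summable_lambertTerm hQ0 hQ hw0 hw).hasSum
  have h2 : HasSum (fun i : ℤ => if i = 0 then (-1 : ℂ) else 0) (-1) := by
    simpa using hasSum_ite_eq (0 : ℤ) (-1 : ℂ)
  have h := (h1.congr_fun (g := fun i : ℤ => if i = 0 then (-1 : ℂ) else 0) fun i => ?_).unique h2
  · exact eq_sub_of_add_eq h
  · simp only [Function.comp_apply, Equiv.neg_apply]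
    rw [lambertTerm_eq hw, lambertTerm_eq hw']
    have ha := hw i
    have hb := hw' (-i)
    have hQi := zpow_ne_zero i hQ0
    rw [zpow_neg] at hb ⊢
    have hb' : w * Q ^ i - 1 ≠ 0 := fun h => ha (by linear_combination -h)
    have key : w⁻¹ * (Q ^ i)⁻¹ / (1 - w⁻¹ * (Q ^ i)⁻¹) + w * Q ^ i / (1 - w * Q ^ i) = -1 := by
      rw [← neg_sub (w * Q ^ i) 1, div_neg]
      field_simp
      ring
    rw [add_add_add_comm, key]
    split_ifs <;> first | lia | simp

/-- The convolution is applied to (x, y) and to (xyw, w⁻¹). Both pairs have product xy, so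
subtracting removes the n-weighted part, and the second product is zero because F(w⁻¹, w) = 0. -/
theorem kronecker_mul_kronecker {Q x y w : ℂ} (hQ0 : Q ≠ 0) (hQ : ‖Q‖ < 1) (hx0 : x ≠ 0)
    (hx : ∀ n : ℤ, 1 - x * Q ^ n ≠ 0) (hy0 : y ≠ 0) (hy : ∀ n : ℤ, 1 - y * Q ^ n ≠ 0)
    (hxy : ∀ n : ℤ, 1 - x * y * Q ^ n ≠ 0) (hxyw : ∀ n : ℤ, 1 - x * y * w * Q ^ n ≠ 0)
    (hQw : ‖Q‖ < ‖w‖) (hw : ‖w‖ < 1) (hwn : ∀ n : ℤ, 1 - w * Q ^ n ≠ 0)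
    (hwn' : ∀ n : ℤ, 1 - w⁻¹ * Q ^ n ≠ 0) (h0 : kronecker Q w⁻¹ w = 0) :
    kronecker Q x w * kronecker Q y w =
      (1 + lambert Q x + lambert Q y + lambert Q w - lambert Q (x * y * w)) *
        kronecker Q (x * y) w := by
  have hw0 : w ≠ 0 := norm_pos_iff.mp ((norm_nonneg Q).trans_lt hQw)
  have hcancel : x * y * w * w⁻¹ = x * y := mul_inv_cancel_right₀ hw0 _
  have h1 := hasSum_convolution_kronecker hQ0 hQ hx0 hx hy0 hy hxy hQw hw
  have h2 := hasSum_convolution_kronecker hQ0 hQ (by simp [hx0, hy0, hw0]) hxyw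
    (inv_ne_zero hw0) hwn' (by rwa [hcancel]) hQw hw
  have h3 := (summable_norm_kronecker hQ0 hQ (mul_ne_zero hx0 hy0) hxy hQw hw).of_norm.hasSum.mul_left
    (1 + lambert Q x + lambert Q y + lambert Q w - lambert Q (x * y * w))
  rw [hcancel, h0, mul_zero, lambert_inv hQ0 hQ hw0 hwn hwn'] at h2
  have h4 := (h1.sub h2).congr_fun (g := fun n : ℤ =>
    (1 + lambert Q x + lambert Q y + lambert Q w - lambert Q (x * y * w)) *
      (w ^ n / (1 - x * y * Q ^ n))) fun n => by ring
  rw [sub_zero] at h4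
  exact h4.unique h3

/-! ### The Jacobi triple product -/

/-- The integer `n (n - 1) / 2`. -/
def tri (n : ℤ) : ℤ := n * (n - 1) / 2

@[simp] theorem tri_zero : tri 0 = 0 := by simp [tri]

theorem tri_add_one (n : ℤ) : tri (n + 1) = tri n + n := by
  rw [tri, tri, show (n + 1) * (n + 1 - 1) = n * (n - 1) + n * 2 by ring,
    Int.add_mul_ediv_right _ _ two_ne_zero]

theorem tri_one_sub (n : ℤ) : tri (1 - n) = tri n := by
  rw [tri, tri]
  congr 1
  ring

theorem tri_add_natCast (n : ℤ) (m : ℕ) : tri (n + m) = tri n + tri m + n * m := by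
  induction m with
  | zero => simp
  | succ k ih =>
    push_cast
    rw [← add_assoc, tri_add_one, tri_add_one, ih]
    ring

/-- The finite product `(Q; Q)_n`. -/
def qFac (Q : ℂ) (n : ℕ) : ℂ := ∏ k ∈ Finset.range n, (1 - Q * Q ^ k)

theorem one_sub_mul_pow_ne_zero {Q : ℂ} (hQ : ‖Q‖ < 1) (k : ℕ) : 1 - Q * Q ^ k ≠ 0 := by
  intro h
  have h1 : Q ^ (k + 1) = 1 := by rw [pow_succ']; exact (sub_eq_zero.mp h).symm
  have h2 : ‖Q‖ ^ (k + 1) = 1 := by rw [← norm_pow, h1, norm_one]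
  exact (pow_lt_one₀ (norm_nonneg Q) hQ k.succ_ne_zero).ne h2

theorem qFac_ne_zero {Q : ℂ} (hQ : ‖Q‖ < 1) (n : ℕ) : qFac Q n ≠ 0 :=
  Finset.prod_ne_zero_iff.mpr fun k _ => one_sub_mul_pow_ne_zero hQ k

theorem qFac_succ (Q : ℂ) (n : ℕ) : qFac Q (n + 1) = qFac Q n * (1 - Q * Q ^ n) :=
  Finset.prod_range_succ _ _

@[simp] theorem qFac_zero (Q : ℂ) : qFac Q 0 = 1 := by simp [qFac]

theorem prod_mul_qPoch (a : ℂ) {Q : ℂ} (hQ : ‖Q‖ < 1) (n : ℕ) :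
    (∏ k ∈ Finset.range n, (1 - a * Q ^ k)) * qPoch (a * Q ^ n) Q = qPoch a Q := by
  have e (k : ℕ) : 1 - a * Q ^ n * Q ^ k = 1 - a * Q ^ (k + n) := by
    rw [pow_add]
    ring
  have h := multipliable_qPoch (a * Q ^ n) hQ
  simp only [e] at h
  simp only [qPoch, e]
  exact h.prod_mul_tprod_nat_mul' (f := fun k => 1 - a * Q ^ k)

theorem qPoch_eq_one_sub_mul (a : ℂ) {Q : ℂ} (hQ : ‖Q‖ < 1) :
    qPoch a Q = (1 - a) * qPoch (a * Q) Q := by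
  simpa using (prod_mul_qPoch a hQ 1).symm

theorem qPoch_eq_zero {a Q : ℂ} (hQ : ‖Q‖ < 1) (k : ℕ) (h : a * Q ^ k = 1) : qPoch a Q = 0 := by
  rw [← prod_mul_qPoch a hQ (k + 1), Finset.prod_range_succ, h]
  simp

theorem qPoch_ne_zero {a Q : ℂ} (hQ : ‖Q‖ < 1) (h : ∀ k : ℕ, 1 - a * Q ^ k ≠ 0) :
    qPoch a Q ≠ 0 := by
  have hs : Summable fun k : ℕ => ‖-(a * Q ^ k)‖ := by
    simpa [norm_mul, norm_pow] using
      (summable_geometric_of_lt_one (norm_nonneg Q) hQ).mul_left ‖a‖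
  have := tprod_one_add_ne_zero_of_summable (f := fun k : ℕ => -(a * Q ^ k))
    (fun k => by simpa [← sub_eq_add_neg] using h k) hs
  simpa [qPoch, ← sub_eq_add_neg] using this

theorem continuous_qPoch {Q : ℂ} (hQ : ‖Q‖ < 1) : Continuous fun a => qPoch a Q := by
  rw [continuous_iff_continuousAt]
  intro a
  have hb : Summable fun k : ℕ => (‖a‖ + 1) * ‖Q‖ ^ k :=
    (summable_geometric_of_lt_one (norm_nonneg Q) hQ).mul_left _
  have h := tendsto_tprod_one_add_of_dominated_convergence (𝓕 := 𝓝 a)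
    (f := fun b (k : ℕ) => -(b * Q ^ k)) (g := fun k : ℕ => -(a * Q ^ k)) hb
    (fun k => (Continuous.tendsto (by fun_prop) a)) ?_
  · simpa [ContinuousAt, qPoch, ← sub_eq_add_neg] using h
  · have hn : ∀ᶠ b in 𝓝 a, ‖b‖ < ‖a‖ + 1 :=
      continuous_norm.continuousAt.eventually_lt continuousAt_const (lt_add_one _)
    filter_upwards [hn] with b hb k
    rw [norm_neg, norm_mul, norm_pow]
    gcongr

theorem tendsto_prod_qPoch (a : ℂ) {Q : ℂ} (hQ : ‖Q‖ < 1) :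
    Tendsto (fun n => ∏ k ∈ Finset.range n, (1 - a * Q ^ k)) atTop (𝓝 (qPoch a Q)) :=
  (multipliable_qPoch a hQ).hasProd.tendsto_prod_nat

/-- Closes both of Euler's expansions: after iterating a functional equation in z ↦ zQ, only the
constant coefficient survives. -/
theorem tendsto_tsum_mul_pow {Q z : ℂ} (hQ : ‖Q‖ < 1) {c : ℕ → ℂ}
    (hc : Summable fun n => ‖c n * z ^ n‖) :
    Tendsto (fun k : ℕ => ∑' n, c n * (z * Q ^ k) ^ n) atTop (𝓝 (c 0)) := by
  have h0 : ∑' n : ℕ, (if n = 0 then c 0 else 0) = c 0 := tsum_ite_eq 0 _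
  rw [← h0]
  refine tendsto_tsum_of_dominated_convergence hc (fun n => ?_) (Eventually.of_forall fun k n => ?_)
  · rcases n with _ | n
    · simp
    · have hp := tendsto_pow_atTop_nhds_zero_of_norm_lt_one hQ
      have := ((hp.const_mul z).pow (n + 1)).const_mul (c (n + 1))
      simpa using this
  · rw [mul_pow, ← mul_assoc, norm_mul]
    refine mul_le_of_le_one_right (norm_nonneg _) ?_
    rw [← pow_mul, norm_pow]
    exact pow_le_one₀ (norm_nonneg _) hQ.le

theorem summable_of_ratio {f : ℕ → ℂ} {g : ℕ → ℂ} {l : ℂ} (hf : ∀ n, f n ≠ 0)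
    (h : ∀ n, f (n + 1) = g n * f n) (hg : Tendsto g atTop (𝓝 l)) (hl : ‖l‖ < 1) :
    Summable fun n => ‖f n‖ := by
  refine summable_of_ratio_test_tendsto_lt_one hl
    (Eventually.of_forall fun n => norm_ne_zero_iff.mpr (hf n)) ?_
  refine hg.norm.congr fun n => ?_
  rw [h, norm_mul, norm_norm, Real.norm_of_nonneg (by positivity),
    mul_div_cancel_right₀ _ (norm_ne_zero_iff.mpr (hf n))]

/-- The coefficients of Euler's expansion of `(z; Q)_∞`. -/
def eulerCoeff (Q : ℂ) (n : ℕ) : ℂ := (-1) ^ n * Q ^ tri n / qFac Q n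

theorem eulerCoeff_succ {Q : ℂ} (hQ0 : Q ≠ 0) (n : ℕ) :
    eulerCoeff Q (n + 1) = -Q ^ n / (1 - Q * Q ^ n) * eulerCoeff Q n := by
  rw [eulerCoeff, eulerCoeff, qFac_succ]
  push_cast
  rw [tri_add_one, zpow_add₀ hQ0, zpow_natCast, pow_succ, div_mul_div_comm]
  congr 1 <;> ring

theorem eulerCoeff_ne_zero {Q : ℂ} (hQ0 : Q ≠ 0) (hQ : ‖Q‖ < 1) (n : ℕ) : eulerCoeff Q n ≠ 0 :=
  div_ne_zero (mul_ne_zero (by simp) (zpow_ne_zero _ hQ0)) (qFac_ne_zero hQ n)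

theorem tendsto_one_sub_mul_pow {Q : ℂ} (hQ : ‖Q‖ < 1) :
    Tendsto (fun n : ℕ => 1 - Q * Q ^ n) atTop (𝓝 1) := by
  have hp := tendsto_pow_atTop_nhds_zero_of_norm_lt_one hQ
  simpa using tendsto_const_nhds.sub (hp.const_mul Q)

theorem summable_eulerCoeff_mul_pow {Q z : ℂ} (hQ0 : Q ≠ 0) (hQ : ‖Q‖ < 1) (hz : z ≠ 0) :
    Summable fun n => ‖eulerCoeff Q n * z ^ n‖ := by
  have hp := tendsto_pow_atTop_nhds_zero_of_norm_lt_one hQ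
  refine summable_of_ratio (g := fun n => -Q ^ n / (1 - Q * Q ^ n) * z) (l := 0)
    (fun n => mul_ne_zero (eulerCoeff_ne_zero hQ0 hQ n) (pow_ne_zero _ hz)) (fun n => ?_) ?_
    (by simp)
  · rw [eulerCoeff_succ hQ0, pow_succ]
    ring
  · simpa using (hp.neg.div (tendsto_one_sub_mul_pow hQ) one_ne_zero).mul_const z

theorem summable_pow_div_qFac {Q z : ℂ} (hQ : ‖Q‖ < 1) (hz0 : z ≠ 0) (hz : ‖z‖ < 1) :
    Summable fun n => ‖1 / qFac Q n * z ^ n‖ := by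
  refine summable_of_ratio (g := fun n => z / (1 - Q * Q ^ n)) (l := z)
    (fun n => mul_ne_zero (one_div_ne_zero (qFac_ne_zero hQ n)) (pow_ne_zero _ hz0))
    (fun n => ?_) ?_ hz
  · rw [qFac_succ, pow_succ, one_div_mul_eq_div, one_div_mul_eq_div, div_mul_div_comm]
    congr 1 <;> ring
  · have h := (tendsto_const_nhds (x := z)).div (tendsto_one_sub_mul_pow hQ) one_ne_zero
    rw [div_one] at h
    exact h

/-- The series satisfies f(z) = (1 - z) f(zQ) and tends to 1 along zQ^k. -/
theorem tsum_eulerCoeff_mul_pow {Q z : ℂ} (hQ0 : Q ≠ 0) (hQ : ‖Q‖ < 1) (hz : z ≠ 0) :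
    ∑' n, eulerCoeff Q n * z ^ n = qPoch z Q := by
  have step (y : ℂ) (hy : y ≠ 0) : ∑' n, eulerCoeff Q n * y ^ n =
      (1 - y) * ∑' n, eulerCoeff Q n * (y * Q) ^ n := by
    have h1 := (summable_eulerCoeff_mul_pow hQ0 hQ hy).of_norm
    have h2 := (summable_eulerCoeff_mul_pow hQ0 hQ (mul_ne_zero hy hQ0)).of_norm
    have h3 : ∑' n, (eulerCoeff Q n * y ^ n - eulerCoeff Q n * (y * Q) ^ n) =
        -y * ∑' n, eulerCoeff Q n * (y * Q) ^ n := by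
      rw [(h1.sub h2).tsum_eq_zero_add, ← tsum_mul_left]
      simp only [pow_zero, sub_self, zero_add]
      refine tsum_congr fun n => ?_
      have hn : eulerCoeff Q (n + 1) * (1 - Q * Q ^ n) = -Q ^ n * eulerCoeff Q n := by
        rw [eulerCoeff_succ hQ0, mul_right_comm, div_mul_cancel₀ _ (one_sub_mul_pow_ne_zero hQ n)]
      rw [mul_pow, mul_pow, pow_succ, pow_succ]
      linear_combination y ^ n * y * hn
    rw [h1.tsum_sub h2] at h3
    linear_combination h3
  have iter (k : ℕ) : ∑' n, eulerCoeff Q n * z ^ n =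
      (∏ j ∈ Finset.range k, (1 - z * Q ^ j)) * ∑' n, eulerCoeff Q n * (z * Q ^ k) ^ n := by
    induction k with
    | zero => simp
    | succ k ih =>
      rw [ih, step _ (mul_ne_zero hz (pow_ne_zero k hQ0)), Finset.prod_range_succ, mul_assoc z,
        ← pow_succ, mul_assoc]
  have h := (tendsto_prod_qPoch z hQ).mul
    (tendsto_tsum_mul_pow hQ (summable_eulerCoeff_mul_pow hQ0 hQ hz))
  have h0 : eulerCoeff Q 0 = 1 := by simp [eulerCoeff]
  rw [h0, mul_one] at h
  exact tendsto_nhds_unique (tendsto_const_nhds.congr iter) h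

/-- Euler's expansion of 1/(z;Q)_∞, from (1 - z) f(z) = f(zQ). -/
theorem qPoch_mul_tsum_pow_div_qFac {Q z : ℂ} (hQ0 : Q ≠ 0) (hQ : ‖Q‖ < 1) (hz0 : z ≠ 0)
    (hz : ‖z‖ < 1) : qPoch z Q * ∑' n, 1 / qFac Q n * z ^ n = 1 := by
  have step (y : ℂ) (hy0 : y ≠ 0) (hy : ‖y‖ < 1) : (1 - y) * ∑' n, 1 / qFac Q n * y ^ n =
      ∑' n, 1 / qFac Q n * (y * Q) ^ n := by
    have hyQ : ‖y * Q‖ < 1 := by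
      rw [norm_mul]
      exact mul_lt_one_of_nonneg_of_lt_one_left (norm_nonneg _) hy hQ.le
    have h1 := (summable_pow_div_qFac hQ hy0 hy).of_norm
    have h2 := (summable_pow_div_qFac hQ (mul_ne_zero hy0 hQ0) hyQ).of_norm
    have h3 : ∑' n, (1 / qFac Q n * y ^ n - 1 / qFac Q n * (y * Q) ^ n) =
        y * ∑' n, 1 / qFac Q n * y ^ n := by
      rw [(h1.sub h2).tsum_eq_zero_add, ← tsum_mul_left]
      simp only [pow_zero, sub_self, zero_add]
      refine tsum_congr fun n => ?_
      have hn := one_sub_mul_pow_ne_zero hQ n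
      have hf := qFac_ne_zero hQ n
      rw [qFac_succ, mul_pow, pow_succ, pow_succ]
      field_simp
    rw [h1.tsum_sub h2] at h3
    linear_combination h3
  have iter (k : ℕ) : (∏ j ∈ Finset.range k, (1 - z * Q ^ j)) * ∑' n, 1 / qFac Q n * z ^ n =
      ∑' n, 1 / qFac Q n * (z * Q ^ k) ^ n := by
    induction k with
    | zero => simp
    | succ k ih =>
      have hk : ‖z * Q ^ k‖ < 1 := by
        rw [norm_mul, norm_pow]
        exact mul_lt_one_of_nonneg_of_lt_one_left (norm_nonneg _) hz
          (pow_le_one₀ (norm_nonneg _) hQ.le)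
      rw [pow_succ, ← mul_assoc z, ← step _ (mul_ne_zero hz0 (pow_ne_zero k hQ0)) hk, ← ih,
        Finset.prod_range_succ]
      ring
  have h := (tendsto_prod_qPoch z hQ).mul_const (∑' n, 1 / qFac Q n * z ^ n)
  have h' := tendsto_tsum_mul_pow hQ (summable_pow_div_qFac hQ hz0 hz)
  rw [qFac_zero, div_one] at h'
  exact tendsto_nhds_unique h (h'.congr fun k => (iter k).symm)

/-- The terms of Jacobi's theta series. -/
def thetaTerm (Q z : ℂ) (n : ℤ) : ℂ := (-1) ^ n * Q ^ tri n * z ^ n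

/-- Jacobi's theta series `∑ (-1) ^ n Q ^ (n (n - 1) / 2) z ^ n`. -/
def thetaSeries (Q z : ℂ) : ℂ := ∑' n : ℤ, thetaTerm Q z n

/-- The theta product `(z, Q / z; Q)_∞`. -/
def theta (Q z : ℂ) : ℂ := qPoch z Q * qPoch (Q / z) Q

theorem thetaTerm_add_one {Q z : ℂ} (hQ0 : Q ≠ 0) (hz : z ≠ 0) (n : ℤ) :
    thetaTerm Q z (n + 1) = -z * Q ^ n * thetaTerm Q z n := by
  rw [thetaTerm, thetaTerm, tri_add_one, zpow_add₀ hQ0, zpow_add_one₀ hz,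
    zpow_add_one₀ (by simp)]
  ring

theorem thetaTerm_ne_zero {Q z : ℂ} (hQ0 : Q ≠ 0) (hz : z ≠ 0) (n : ℤ) : thetaTerm Q z n ≠ 0 :=
  mul_ne_zero (mul_ne_zero (zpow_ne_zero _ (by simp)) (zpow_ne_zero _ hQ0)) (zpow_ne_zero _ hz)

theorem summable_norm_thetaTerm {Q z : ℂ} (hQ0 : Q ≠ 0) (hQ : ‖Q‖ < 1) (hz : z ≠ 0) :
    Summable fun n => ‖thetaTerm Q z n‖ := by
  have hp := tendsto_pow_atTop_nhds_zero_of_norm_lt_one hQ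
  refine Summable.of_nat_of_neg_add_one ?_ ?_
  · refine summable_of_ratio (f := fun n : ℕ => thetaTerm Q z n) (g := fun n => -z * Q ^ n) (l := 0)
      (fun n => thetaTerm_ne_zero hQ0 hz n) (fun n => ?_) (by simpa using hp.const_mul (-z))
      (by simp)
    push_cast
    rw [thetaTerm_add_one hQ0 hz, zpow_natCast]
  · refine summable_of_ratio (f := fun n : ℕ => thetaTerm Q z (-((n : ℤ) + 1)))
      (g := fun n => -(Q ^ 2 / z) * Q ^ n) (l := 0)
      (fun n => thetaTerm_ne_zero hQ0 hz _) (fun n => ?_)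
      (by simpa using hp.const_mul (-(Q ^ 2 / z))) (by simp)
    have h := thetaTerm_add_one hQ0 hz (-((n : ℤ) + 2))
    rw [show -((n : ℤ) + 2) + 1 = -(n + 1) by ring] at h
    push_cast
    rw [h, show -((n : ℤ) + 1 + 1) = -(n + 2) by ring, zpow_neg]
    have h2 : Q ^ ((n : ℤ) + 2) = Q ^ (n + 2) := by norm_cast
    have hQn := pow_ne_zero n hQ0
    rw [h2, pow_add]
    field_simp

/-- The substitution n ↦ 1 - n changes the sign of every term. -/
theorem thetaSeries_one (Q : ℂ) : thetaSeries Q 1 = 0 := by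
  have h : thetaSeries Q 1 = -thetaSeries Q 1 := by
    conv_lhs => rw [thetaSeries, ← (Equiv.subLeft (1 : ℤ)).tsum_eq]
    rw [thetaSeries, ← tsum_neg]
    refine tsum_congr fun n => ?_
    simp only [Equiv.subLeft_apply, thetaTerm, tri_one_sub, one_zpow, mul_one]
    rw [zpow_sub₀ (by simp), zpow_one, div_eq_mul_inv, ← inv_zpow]
    norm_num
  exact self_eq_neg.mp h

/-- Multiply the theta series by Euler's series for 1/(Q/z;Q)_∞. The collected n-th term carries the
factor (Q^(n+1);Q)_∞, which vanishes for n < 0; for n ≥ 0 it is (Q;Q)_∞/(Q;Q)_n, leaving Euler's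
series for (z;Q)_∞. -/
theorem thetaSeries_eq {Q z : ℂ} (hQ0 : Q ≠ 0) (hQ : ‖Q‖ < 1) (hz : ‖Q‖ < ‖z‖) :
    thetaSeries Q z = qPoch Q Q * theta Q z := by
  have hz0 : z ≠ 0 := norm_pos_iff.mp ((norm_nonneg Q).trans_lt hz)
  have hQz0 : Q / z ≠ 0 := div_ne_zero hQ0 hz0
  have hQz : ‖Q / z‖ < 1 := by
    rw [norm_div]
    exact (div_lt_one (norm_pos_iff.mpr hz0)).mpr hz
  have h1 := hasSum_mul_of_hasSum_fiber (c := fun n : ℤ => thetaTerm Q z n * qPoch (Q ^ (n + 1)) Q)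
    (fun m : ℕ => -(m : ℤ)) (summable_norm_thetaTerm hQ0 hQ hz0)
    (summable_pow_div_qFac hQ hQz0 hQz) fun n => by
      have hn : Q ^ (n + 1) ≠ 0 := zpow_ne_zero _ hQ0
      have h := (summable_eulerCoeff_mul_pow hQ0 hQ hn).of_norm.hasSum.mul_left (thetaTerm Q z n)
      rw [tsum_eulerCoeff_mul_pow hQ0 hQ hn] at h
      refine h.congr_fun fun m => ?_
      rw [sub_neg_eq_add, thetaTerm, thetaTerm, tri_add_natCast, eulerCoeff, zpow_add₀ hQ0,
        zpow_add₀ hQ0, zpow_add₀ hz0, zpow_add₀ (by simp), zpow_mul, zpow_natCast, zpow_natCast,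
        zpow_natCast, zpow_add_one₀ hQ0, div_pow, mul_pow]
      have := pow_ne_zero m hz0
      field_simp
  have h2 : HasSum (fun n : ℤ => thetaTerm Q z n * qPoch (Q ^ (n + 1)) Q)
      (qPoch Q Q * qPoch z Q) := by
    have h := (summable_eulerCoeff_mul_pow hQ0 hQ hz0).of_norm.hasSum.mul_left (qPoch Q Q)
    rw [tsum_eulerCoeff_mul_pow hQ0 hQ hz0] at h
    rw [← Function.Injective.hasSum_iff Nat.cast_injective] 
    · refine h.congr_fun fun n => ?_
      have hp := prod_mul_qPoch Q hQ n
      rw [← pow_succ', ← qFac] at hp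
      have hf := qFac_ne_zero hQ n
      have hc : Q ^ ((n : ℤ) + 1) = Q ^ (n + 1) := by norm_cast
      simp only [Function.comp_apply]
      rw [← hp, thetaTerm, eulerCoeff, hc, zpow_natCast, zpow_natCast]
      field_simp
    · intro n hn
      have hneg : n < 0 := by
        by_contra hcon
        exact hn ⟨n.toNat, Int.toNat_of_nonneg (by lia)⟩
      rw [qPoch_eq_zero hQ (-(n + 1)).toNat, mul_zero]
      rw [← zpow_natCast, Int.toNat_of_nonneg (by lia), ← zpow_add₀ hQ0]
      simp
  have h3 := h1.unique h2
  have h4 := qPoch_mul_tsum_pow_div_qFac hQ0 hQ hQz0 hQz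
  rw [theta, ← mul_assoc, ← h3, thetaSeries, mul_assoc, mul_comm _ (qPoch (Q / z) Q), h4, mul_one]

/-! ### Product formula for the Kronecker series -/

/-- The constant Laurent coefficient of `θ(w) ∑ w ^ n / (1 - a Q ^ n)`. -/
def kroneckerConst (Q a : ℂ) : ℂ := ∑' i : ℤ, thetaTerm Q 1 i / (1 - a * Q ^ (-i))

/-- The Laurent coefficients c(n) of the left side obey the recursion of the theta terms at a. Here
a need not lie in the annulus, so a = w⁻¹ is allowed. -/
theorem thetaSeries_mul_kronecker {Q a w : ℂ} (hQ0 : Q ≠ 0) (hQ : ‖Q‖ < 1) (ha0 : a ≠ 0)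
    (ha : ∀ n : ℤ, 1 - a * Q ^ n ≠ 0) (hQw : ‖Q‖ < ‖w‖) (hw : ‖w‖ < 1) :
    thetaSeries Q w * kronecker Q a w = kroneckerConst Q a * thetaSeries Q (a * w) := by
  have hw0 : w ≠ 0 := norm_pos_iff.mp ((norm_nonneg Q).trans_lt hQw)
  have hk := summable_norm_kronecker hQ0 hQ ha0 ha hQw hw
  have ht := summable_norm_thetaTerm hQ0 hQ hw0
  let c : ℤ → ℂ := fun n => ∑' i : ℤ, thetaTerm Q 1 i / (1 - a * Q ^ (n - i))
  have hterm (n i : ℤ) : w ^ (n - i) / (1 - a * Q ^ (n - i)) * thetaTerm Q w i =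
      w ^ n * (thetaTerm Q 1 i / (1 - a * Q ^ (n - i))) := by
    have := zpow_ne_zero i hw0
    rw [zpow_sub₀ hw0, thetaTerm, thetaTerm, one_zpow, mul_one]
    field_simp
  have hcs (n : ℤ) : Summable fun i : ℤ => thetaTerm Q 1 i / (1 - a * Q ^ (n - i)) := by
    have h : Summable fun i : ℤ => w ^ n * (thetaTerm Q 1 i / (1 - a * Q ^ (n - i))) := by
      obtain ⟨C, hC⟩ : ∃ C, ∀ j, ‖w ^ j / (1 - a * Q ^ j)‖ ≤ C :=
        ⟨_, fun j => hk.le_tsum j fun _ _ => norm_nonneg _⟩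
      refine Summable.of_norm_bounded (ht.mul_left C) fun i => ?_
      rw [← hterm, norm_mul]
      exact mul_le_mul_of_nonneg_right (hC _) (norm_nonneg _)
    exact (summable_mul_left_iff (zpow_ne_zero n hw0)).mp h
  -- Write 1 = (1 - aQ^(n+1-i)) + aQ^(n+1-i) in each numerator: the first part sums to the theta
  -- series at 1, which is zero, and the second becomes c(n) after shifting i.
  have hc1 (n : ℤ) : c (n + 1) = -a * Q ^ n * c n := by
    have h1 : ∑' i : ℤ, thetaTerm Q 1 i / (1 - a * Q ^ (n + 1 - i)) * (1 - a * Q ^ (n + 1 - i)) =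
        0 := by
      rw [← thetaSeries_one Q]
      exact tsum_congr fun i => div_mul_cancel₀ _ (ha _)
    have h2 : ∑' i : ℤ, thetaTerm Q 1 i / (1 - a * Q ^ (n + 1 - i)) * (a * Q ^ (n + 1 - i)) =
        -a * Q ^ n * c n := by
      rw [← (Equiv.addRight (1 : ℤ)).tsum_eq, ← tsum_mul_left]
      refine tsum_congr fun i => ?_
      simp only [Equiv.coe_addRight]
      rw [thetaTerm_add_one hQ0 one_ne_zero, show n + 1 - (i + 1) = n - i by ring, zpow_sub₀ hQ0]
      have := zpow_ne_zero i hQ0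
      field_simp
    have h3 : Summable fun i : ℤ =>
        thetaTerm Q 1 i / (1 - a * Q ^ (n + 1 - i)) * (a * Q ^ (n + 1 - i)) := by
      refine ((hcs (n + 1)).sub (summable_norm_thetaTerm hQ0 hQ one_ne_zero).of_norm).congr
        fun i => ?_
      have := ha (n + 1 - i)
      field_simp
      ring
    rw [← h2, ← sub_eq_zero, ← h1]
    simp only [c]
    rw [← (hcs (n + 1)).tsum_sub h3]
    exact tsum_congr fun i => by ring
  have hc (n : ℤ) : w ^ n * c n = kroneckerConst Q a * thetaTerm Q (a * w) n := by
    suffices h : c n = kroneckerConst Q a * thetaTerm Q a n by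
      rw [h, thetaTerm, thetaTerm, mul_zpow]
      ring
    have h0 : c 0 = kroneckerConst Q a := by simp only [c, kroneckerConst, zero_sub]
    induction n with
    | zero => simp [h0, thetaTerm]
    | succ n ih =>
      rw [hc1, ih, thetaTerm_add_one hQ0 ha0]
      ring
    | pred n ih =>
      have h1 := hc1 (-(n : ℤ) - 1)
      have h2 := thetaTerm_add_one hQ0 ha0 (-(n : ℤ) - 1)
      rw [sub_add_cancel] at h1 h2
      rw [h1, h2] at ih
      have hne : -a * Q ^ (-(n : ℤ) - 1) ≠ 0 :=
        mul_ne_zero (neg_ne_zero.mpr ha0) (zpow_ne_zero _ hQ0)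
      refine mul_left_cancel₀ hne ?_
      rw [ih]
      ring
  have h := hasSum_mul_of_hasSum_fiber (c := fun n => w ^ n * c n) (fun i : ℤ => i) hk ht
    fun n => ((hcs n).hasSum.mul_left (w ^ n)).congr_fun fun i => hterm n i
  rw [thetaSeries, kronecker, mul_comm, ← h.tsum_eq, thetaSeries, ← tsum_mul_left]
  exact tsum_congr hc

theorem lambertTerm_of_neg {Q x : ℂ} {n : ℤ} (hn : n < 0) :
    lambertTerm Q x n = 1 / (1 - x * Q ^ n) := by
  rw [lambertTerm, if_neg (by lia)]

/-- The simple pole at w = 1 comes from the geometric series over n ≥ 0; what is left is a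
Lambert-type series bounded near 1. -/
theorem tendsto_one_sub_mul_kronecker {Q a : ℂ} (hQ0 : Q ≠ 0) (hQ : ‖Q‖ < 1) (ha0 : a ≠ 0)
    (ha : ∀ n : ℤ, 1 - a * Q ^ n ≠ 0) :
    Tendsto (fun t : ℝ => (1 - (t : ℂ)) * kronecker Q a t) (𝓝[<] 1) (𝓝 1) := by
  obtain ⟨r, hQr, hr⟩ := exists_between hQ
  have hr0 : 0 < r := (norm_nonneg Q).trans_lt hQr
  have hnr : ‖(r : ℂ)‖ = r := by rw [Complex.norm_real, Real.norm_of_nonneg hr0.le]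
  have hkr := summable_norm_kronecker hQ0 hQ ha0 ha (w := r) (by rwa [hnr]) (by rwa [hnr])
  have hl := (summable_lambertTerm hQ0 hQ ha0 ha).norm
  -- For n < 0 the factor t^n exceeds 1, so the Kronecker series at the fixed radius r serves as the
  -- majorant.
  have hbound (t : ℝ) (hrt : r < t) (ht : t < 1) (n : ℤ) : ‖(t : ℂ) ^ n * lambertTerm Q a n‖ ≤
      ‖lambertTerm Q a n‖ + ‖(r : ℂ) ^ n / (1 - a * Q ^ n)‖ := by
    have ht0 : 0 < t := hr0.trans hrt
    rw [norm_mul, norm_zpow, Complex.norm_real, Real.norm_of_nonneg ht0.le]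
    rcases le_or_gt 0 n with hn | hn
    · refine le_add_of_le_of_nonneg (mul_le_of_le_one_left (norm_nonneg _) ?_) (norm_nonneg _)
      exact zpow_le_one₀ ht0 ht.le hn
    · refine le_add_of_nonneg_of_le (norm_nonneg _) ?_
      rw [lambertTerm_of_neg hn, norm_div, norm_div, norm_one, norm_zpow, hnr, mul_one_div]
      refine div_le_div_of_nonneg_right ?_ (norm_nonneg _)
      have h := inv_anti₀ (zpow_pos hr0 (-n))
        (zpow_le_zpow_left₀ (neg_nonneg.mpr hn.le) hr0.le hrt.le)
      rwa [zpow_neg, zpow_neg, inv_inv, inv_inv] at h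
  have hform (t : ℝ) (hrt : r < t) (ht : t < 1) : (1 - (t : ℂ)) * kronecker Q a t =
      1 + (1 - (t : ℂ)) * ∑' n : ℤ, (t : ℂ) ^ n * lambertTerm Q a n := by
    have ht0 : 0 < t := hr0.trans hrt
    have hnt : ‖(t : ℂ)‖ = t := by rw [Complex.norm_real, Real.norm_of_nonneg ht0.le]
    have hs : Summable fun n : ℤ => (t : ℂ) ^ n * lambertTerm Q a n :=
      Summable.of_norm_bounded (hl.add hkr) (hbound t hrt ht)
    have hg : HasSum (fun n : ℤ => if 0 ≤ n then (t : ℂ) ^ n else 0) (1 - (t : ℂ))⁻¹ := by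
      rw [← Function.Injective.hasSum_iff (Nat.cast_injective (R := ℤ))]
      · refine (hasSum_geometric_of_norm_lt_one (ξ := (t : ℂ)) (by rwa [hnt])).congr_fun
          fun n => ?_
        simp
      · intro n hn
        refine if_neg fun hcon => hn ⟨n.toNat, Int.toNat_of_nonneg hcon⟩
    have h := hg.add hs.hasSum
    have hk : kronecker Q a t = (1 - (t : ℂ))⁻¹ + ∑' n : ℤ, (t : ℂ) ^ n * lambertTerm Q a n := by
      rw [kronecker, ← h.tsum_eq]
      refine tsum_congr fun n => ?_
      have := ha n
      rw [lambertTerm]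
      split_ifs
      · field_simp
        ring
      · rw [zero_add, mul_one_div]
    have h1 : 1 - (t : ℂ) ≠ 0 := by
      rw [sub_ne_zero]
      exact_mod_cast ht.ne'
    rw [hk, mul_add, mul_inv_cancel₀ h1]
  have hev : ∀ᶠ t in 𝓝[<] (1 : ℝ), r < t ∧ t < 1 := Ioo_mem_nhdsLT hr
  have hlim : Tendsto (fun t : ℝ => (1 - (t : ℂ)) * ∑' n : ℤ, (t : ℂ) ^ n * lambertTerm Q a n)
      (𝓝[<] 1) (𝓝 0) := by
    let B := ∑' n : ℤ, (‖lambertTerm Q a n‖ + ‖(r : ℂ) ^ n / (1 - a * Q ^ n)‖)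
    have h0 : Tendsto (fun t : ℝ => ‖1 - (t : ℂ)‖ * B) (𝓝[<] 1) (𝓝 0) := by
      have : Tendsto (fun t : ℝ => ‖1 - (t : ℂ)‖ * B) (𝓝 1) (𝓝 (‖1 - ((1 : ℝ) : ℂ)‖ * B)) :=
        Continuous.tendsto (by fun_prop) 1
      simp only [Complex.ofReal_one, sub_self, norm_zero, zero_mul] at this
      exact this.mono_left nhdsWithin_le_nhds
    refine squeeze_zero_norm' ?_ h0
    filter_upwards [hev] with t ht
    rw [norm_mul]
    refine mul_le_mul_of_nonneg_left ?_ (norm_nonneg _)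
    exact tsum_of_norm_bounded (hl.add hkr).hasSum (hbound t ht.1 ht.2)
  have := (tendsto_const_nhds (x := (1 : ℂ))).add hlim
  rw [add_zero] at this
  refine this.congr' ?_
  filter_upwards [hev] with t ht
  exact (hform t ht.1 ht.2).symm

/-- Let w = t → 1⁻ in `thetaSeries_mul_kronecker`: the factor 1 - t of θ(t) cancels the pole of the
Kronecker series, and the limit fixes the constant. -/
theorem kroneckerConst_mul_theta {Q a : ℂ} (hQ0 : Q ≠ 0) (hQ : ‖Q‖ < 1)
    (ha : ∀ n : ℤ, 1 - a * Q ^ n ≠ 0) (hQa : ‖Q‖ < ‖a‖) :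
    kroneckerConst Q a * theta Q a = qPoch Q Q ^ 2 := by
  have ha0 : a ≠ 0 := norm_pos_iff.mp ((norm_nonneg Q).trans_lt hQa)
  have hcont := continuous_qPoch hQ
  have hQQ : qPoch Q Q ≠ 0 := qPoch_ne_zero hQ (one_sub_mul_pow_ne_zero hQ)
  have hlt1 : ‖Q‖ / ‖a‖ < 1 := (div_lt_one (norm_pos_iff.mpr ha0)).mpr hQa
  have hev : ∀ᶠ t in 𝓝[<] (1 : ℝ), max ‖Q‖ (‖Q‖ / ‖a‖) < t ∧ t < 1 :=
    Ioo_mem_nhdsLT (max_lt hQ hlt1)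
  have hid : Tendsto (fun t : ℝ => (t : ℂ)) (𝓝[<] 1) (𝓝 1) := by
    have : Tendsto (fun t : ℝ => (t : ℂ)) (𝓝 1) (𝓝 ((1 : ℝ) : ℂ)) :=
      Complex.continuous_ofReal.tendsto 1
    exact this.mono_left nhdsWithin_le_nhds
  have hA : Tendsto (fun t : ℝ => (1 - (t : ℂ)) * kronecker Q a t *
      (qPoch (t * Q) Q * qPoch (Q / t) Q)) (𝓝[<] 1) (𝓝 (1 * (qPoch Q Q * qPoch Q Q))) := by
    refine (tendsto_one_sub_mul_kronecker hQ0 hQ ha0 ha).mul (Tendsto.mul ?_ ?_)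
    · have := (hcont.tendsto Q).comp (f := fun t : ℝ => (t : ℂ) * Q) (x := 𝓝[<] 1)
        (by simpa using hid.mul_const Q)
      exact this
    · have := (hcont.tendsto Q).comp (f := fun t : ℝ => Q / (t : ℂ)) (x := 𝓝[<] 1)
        (by
        have := (tendsto_const_nhds (x := Q)).div hid one_ne_zero
        rwa [div_one] at this)
      exact this
  have hB : Tendsto (fun t : ℝ => kroneckerConst Q a * theta Q (a * t)) (𝓝[<] 1)
      (𝓝 (kroneckerConst Q a * theta Q a)) := by
    refine Tendsto.const_mul _ (Tendsto.mul ?_ ?_)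
    · have := (hcont.tendsto a).comp (f := fun t : ℝ => a * (t : ℂ)) (x := 𝓝[<] 1)
        (by simpa using hid.const_mul a)
      exact this
    · have := (hcont.tendsto (Q / a)).comp (f := fun t : ℝ => Q / (a * (t : ℂ))) (x := 𝓝[<] 1)
        (by
        have := (tendsto_const_nhds (x := Q)).div (hid.const_mul a) (by simpa using ha0)
        rwa [mul_one] at this)
      exact this
  rw [one_mul, ← sq] at hA
  refine tendsto_nhds_unique (hB.congr' ?_) hA
  filter_upwards [hev] with t ht
  obtain ⟨h1, h2⟩ := max_lt_iff.mp ht.1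
  have ht0 : 0 < t := (norm_nonneg Q).trans_lt h1
  have hnt : ‖(t : ℂ)‖ = t := by rw [Complex.norm_real, Real.norm_of_nonneg ht0.le]
  have hat : ‖Q‖ < ‖a * t‖ := by
    rw [norm_mul, hnt, mul_comm]
    exact (div_lt_iff₀ (norm_pos_iff.mpr ha0)).mp h2
  have h := thetaSeries_mul_kronecker hQ0 hQ ha0 ha (w := t) (by rwa [hnt]) (by rw [hnt]; exact ht.2)
  rw [thetaSeries_eq hQ0 hQ hat, thetaSeries_eq hQ0 hQ (by rwa [hnt]), theta,
    qPoch_eq_one_sub_mul (t : ℂ) hQ] at h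
  refine mul_left_cancel₀ hQQ ?_
  linear_combination -h

/-! ### Nonvanishing of theta and the four-term Lambert identity -/

theorem theta_ne_zero {Q z : ℂ} (hQ : ‖Q‖ < 1) (hz0 : z ≠ 0)
    (hz : ∀ n : ℤ, 1 - z * Q ^ n ≠ 0) : theta Q z ≠ 0 := by
  refine mul_ne_zero (qPoch_ne_zero hQ fun k => mod_cast hz k) (qPoch_ne_zero hQ fun k h => ?_)
  refine hz (-((k : ℤ) + 1)) ?_
  have h1 : Q ^ (-((k : ℤ) + 1)) = (Q ^ (k + 1))⁻¹ := by
    rw [zpow_neg]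
    norm_cast
  have h2 : Q ^ (k + 1) = z := by
    rw [div_mul_eq_mul_div, sub_eq_zero, eq_comm, div_eq_one_iff_eq hz0] at h
    rw [pow_succ', h]
  rw [h1, h2, mul_inv_cancel₀ hz0, sub_self]

theorem one_sub_mul_zpow_ne_zero {Q x : ℂ} (hQ : ‖Q‖ < 1) (hQx : ‖Q‖ < ‖x‖) (hx : ‖x‖ < 1)
    (n : ℤ) : 1 - x * Q ^ n ≠ 0 := by
  intro h
  have h1 : ‖x‖ * ‖Q‖ ^ n = 1 := by
    rw [← norm_zpow, ← norm_mul, ← sub_eq_zero.mp h, norm_one]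
  have hx0 : 0 < ‖x‖ := (norm_nonneg Q).trans_lt hQx
  rcases (norm_nonneg Q).eq_or_lt with h0 | h0
  · rw [← h0] at h1
    rcases eq_or_ne n 0 with rfl | hn
    · simp [hx.ne] at h1
    · simp [zero_zpow n hn] at h1
  rcases le_or_gt 0 n with hn | hn
  · have := zpow_le_one₀ h0 hQ.le hn
    nlinarith
  · have := zpow_le_zpow_right_of_le_one₀ h0 hQ.le (show n ≤ -1 by lia)
    rw [zpow_neg_one] at this
    have h2 : ‖x‖ * ‖Q‖⁻¹ ≤ 1 := h1 ▸ mul_le_mul_of_nonneg_left this hx0.le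
    rw [mul_inv_le_iff₀ h0, one_mul] at h2
    exact absurd h2 hQx.not_ge

theorem one_sub_inv_mul_zpow_ne_zero {Q x : ℂ} (hx0 : x ≠ 0)
    (h : ∀ n : ℤ, 1 - x * Q ^ n ≠ 0) (n : ℤ) : 1 - x⁻¹ * Q ^ n ≠ 0 := by
  intro hn
  apply h (-n)
  have h1 : Q ^ n = x := by
    rw [sub_eq_zero, eq_comm, inv_mul_eq_one₀ hx0] at hn
    exact hn.symm
  rw [zpow_neg, h1, mul_inv_cancel₀ hx0, sub_self]

theorem kronecker_mul_theta {Q a w : ℂ} (hQ0 : Q ≠ 0) (hQ : ‖Q‖ < 1)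
    (hQa : ‖Q‖ < ‖a‖) (ha : ‖a‖ < 1) (hQw : ‖Q‖ < ‖w‖) (hw : ‖w‖ < 1) (hQaw : ‖Q‖ < ‖a * w‖) :
    theta Q w * kronecker Q a w * theta Q a = qPoch Q Q ^ 2 * theta Q (a * w) := by
  have ha0 : a ≠ 0 := norm_pos_iff.mp ((norm_nonneg Q).trans_lt hQa)
  have han := one_sub_mul_zpow_ne_zero hQ hQa ha
  have hQQ : qPoch Q Q ≠ 0 := qPoch_ne_zero hQ (one_sub_mul_pow_ne_zero hQ)
  have h := thetaSeries_mul_kronecker hQ0 hQ ha0 han hQw hw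
  rw [thetaSeries_eq hQ0 hQ hQw, thetaSeries_eq hQ0 hQ hQaw] at h
  refine mul_left_cancel₀ hQQ ?_
  linear_combination theta Q a * h +
    qPoch Q Q * theta Q (a * w) * kroneckerConst_mul_theta hQ0 hQ han hQa

/-- A product of theta functions as a combination of four Lambert series. -/
theorem theta_product_eq_lambert {Q x y w : ℂ} (hQ0 : Q ≠ 0) (hQ : ‖Q‖ < 1)
    (hx : ‖x‖ < 1) (hy : ‖y‖ < 1) (hw : ‖w‖ < 1) (hQxyw : ‖Q‖ < ‖x * y * w‖) :
    qPoch Q Q ^ 2 * theta Q (x * y) * theta Q (y * w) * theta Q (x * w) =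
      (1 + lambert Q x + lambert Q y + lambert Q w - lambert Q (x * y * w)) *
        (theta Q x * theta Q y * theta Q w * theta Q (x * y * w)) := by
  -- The bound on xyw alone forces every partial product into the annulus, as all three factors have
  -- norm below 1.
  have hQxy : ‖Q‖ < ‖x * y‖ := by
    refine hQxyw.trans_le ?_
    rw [norm_mul (x * y)]
    exact mul_le_of_le_one_right (norm_nonneg _) hw.le
  have hQxw : ‖Q‖ < ‖x * w‖ := by
    refine hQxyw.trans_le ?_
    rw [mul_right_comm, norm_mul (x * w)]
    exact mul_le_of_le_one_right (norm_nonneg _) hy.le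
  have hQyw : ‖Q‖ < ‖y * w‖ := by
    refine hQxyw.trans_le ?_
    rw [mul_assoc, norm_mul x]
    exact mul_le_of_le_one_left (norm_nonneg _) hx.le
  have hQx : ‖Q‖ < ‖x‖ := by
    refine hQxy.trans_le ?_
    rw [norm_mul]
    exact mul_le_of_le_one_right (norm_nonneg _) hy.le
  have hQy : ‖Q‖ < ‖y‖ := by
    refine hQxy.trans_le ?_
    rw [norm_mul]
    exact mul_le_of_le_one_left (norm_nonneg _) hx.le
  have hQw : ‖Q‖ < ‖w‖ := by
    refine hQxw.trans_le ?_
    rw [norm_mul]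
    exact mul_le_of_le_one_left (norm_nonneg _) hx.le
  have hxy : ‖x * y‖ < 1 := by
    rw [norm_mul]
    exact mul_lt_one_of_nonneg_of_lt_one_left (norm_nonneg _) hx hy.le
  have hxyw : ‖x * y * w‖ < 1 := by
    rw [norm_mul]
    exact mul_lt_one_of_nonneg_of_lt_one_left (norm_nonneg _) hxy hw.le
  have hne {z : ℂ} (hz : ‖Q‖ < ‖z‖) : z ≠ 0 := norm_pos_iff.mp ((norm_nonneg Q).trans_lt hz)
  have hx' := one_sub_mul_zpow_ne_zero hQ hQx hx
  have hy' := one_sub_mul_zpow_ne_zero hQ hQy hy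
  have hw' := one_sub_mul_zpow_ne_zero hQ hQw hw
  have hxy' := one_sub_mul_zpow_ne_zero hQ hQxy hxy
  have hxyw' := one_sub_mul_zpow_ne_zero hQ hQxyw hxyw
  have hwinv := one_sub_inv_mul_zpow_ne_zero (hne hQw) hw'
  have hQQ : qPoch Q Q ≠ 0 := qPoch_ne_zero hQ (one_sub_mul_pow_ne_zero hQ)
  have hθw := theta_ne_zero hQ (hne hQw) hw'
  have hθxy := theta_ne_zero hQ (hne hQxy) hxy'
  -- Its product formula has the theta series at w⁻¹ w = 1 on the right.
  have hk0 : kronecker Q w⁻¹ w = 0 := by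
    have h := thetaSeries_mul_kronecker hQ0 hQ (inv_ne_zero (hne hQw)) hwinv hQw hw
    rw [inv_mul_cancel₀ (hne hQw), thetaSeries_one, mul_zero, thetaSeries_eq hQ0 hQ hQw] at h
    exact (mul_eq_zero.mp h).resolve_left (mul_ne_zero hQQ hθw)
  have h := kronecker_mul_kronecker hQ0 hQ (hne hQx) hx' (hne hQy) hy' hxy' hxyw' hQw hw hw' hwinv
    hk0
  have kx := kronecker_mul_theta hQ0 hQ hQx hx hQw hw hQxw
  have ky := kronecker_mul_theta hQ0 hQ hQy hy hQw hw hQyw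
  have kxy := kronecker_mul_theta hQ0 hQ hQxy hxy hQw hw hQxyw
  set Λ := 1 + lambert Q x + lambert Q y + lambert Q w - lambert Q (x * y * w)
  have e : (theta Q w * kronecker Q x w * theta Q x) * (theta Q w * kronecker Q y w * theta Q y) *
      theta Q (x * y) = Λ * (theta Q w * kronecker Q (x * y) w * theta Q (x * y)) *
        (theta Q w * theta Q x * theta Q y) := by
    linear_combination theta Q w ^ 2 * theta Q x * theta Q y * theta Q (x * y) * h
  rw [kx, ky, kxy] at e
  refine mul_left_cancel₀ (pow_ne_zero 2 hQQ) ?_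
  linear_combination e

/-! ### The odd Hurwitz zeta function at zero -/

/-- The expression vanishes for linear f. Removing the slope f'(w) leaves a function with derivative
at most 2M, and each of the two differences then costs 2M. -/
theorem norm_sub_sub_mul_sub_le {f f' f'' : ℝ → ℂ} {a M u v w : ℝ}
    (hf : ∀ t ∈ Set.Icc a (a + 2), HasDerivAt f (f' t) t)
    (hf' : ∀ t ∈ Set.Icc a (a + 2), HasDerivAt f' (f'' t) t)
    (hM : ∀ t ∈ Set.Icc a (a + 2), ‖f'' t‖ ≤ M) (hu : u ∈ Set.Icc a (a + 2))
    (hv : v ∈ Set.Icc a (a + 2)) (hw : w ∈ Set.Icc a (a + 2)) (hw1 : w + 1 ∈ Set.Icc a (a + 2))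
    (huv : |u - v| ≤ 1) :
    ‖f u - f v - ((v - u : ℝ) : ℂ) * (f w - f (w + 1))‖ ≤ 4 * M := by
  have hM0 : 0 ≤ M := (norm_nonneg _).trans (hM u hu)
  have hconv : Convex ℝ (Set.Icc a (a + 2)) := convex_Icc a (a + 2)
  have h1 (t : ℝ) (ht : t ∈ Set.Icc a (a + 2)) : ‖f' t - f' w‖ ≤ M * 2 := by
    refine (hconv.norm_image_sub_le_of_norm_hasDerivWithin_le
      (fun t ht => (hf' t ht).hasDerivWithinAt) hM hw ht).trans ?_
    refine mul_le_mul_of_nonneg_left ?_ hM0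
    rw [Real.norm_eq_abs, abs_le]
    constructor <;> linarith [ht.1, ht.2, hw.1, hw.2]
  let h : ℝ → ℂ := fun t => f t - t * f' w
  have hh (t : ℝ) (ht : t ∈ Set.Icc a (a + 2)) :
      HasDerivWithinAt h (f' t - f' w) (Set.Icc a (a + 2)) t := by
    have hid : HasDerivAt (fun t : ℝ => (t : ℂ)) 1 t := Complex.ofRealCLM.hasDerivAt
    have := (hf t ht).sub (hid.mul_const (f' w))
    rw [one_mul] at this
    exact this.hasDerivWithinAt
  have h2 := hconv.norm_image_sub_le_of_norm_hasDerivWithin_le hh h1 hv hu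
  have h3 := hconv.norm_image_sub_le_of_norm_hasDerivWithin_le hh h1 hw1 hw
  rw [Real.norm_eq_abs] at h2 h3
  have e : f u - f v - ((v - u : ℝ) : ℂ) * (f w - f (w + 1)) =
      (h u - h v) - ((v - u : ℝ) : ℂ) * (h w - h (w + 1)) := by
    simp only [h]
    push_cast
    ring
  have h4 : ‖((v - u : ℝ) : ℂ)‖ ≤ 1 := by
    rwa [Complex.norm_real, Real.norm_eq_abs, abs_sub_comm]
  have h5 : |w - (w + 1)| = 1 := by
    rw [sub_add_cancel_left, abs_neg, abs_one]
  rw [e]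
  calc _ ≤ ‖h u - h v‖ + ‖((v - u : ℝ) : ℂ) * (h w - h (w + 1))‖ := norm_sub_le _ _
    _ ≤ M * 2 * 1 + 1 * (M * 2 * 1) := by
      rw [norm_mul]
      rw [h5] at h3
      gcongr
      exact h2.trans (by gcongr)
    _ = 4 * M := by ring

theorem hasDerivAt_ofReal_cpow_neg (s : ℂ) {t : ℝ} (ht : 0 < t) :
    HasDerivAt (fun t : ℝ => (t : ℂ) ^ s) (s * (t : ℂ) ^ (s - 1)) t := by
  have h := (hasDerivAt_id (t : ℂ)).cpow_const (c := s) (Complex.ofReal_mem_slitPlane.mpr ht)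
  rw [mul_one] at h
  exact h.comp_ofReal

theorem hasSum_cpow_sub_cpow {s : ℂ} (hs : 1 < s.re) :
    HasSum (fun n : ℕ => ((n : ℂ) + 1) ^ (-s) - ((n : ℂ) + 2) ^ (-s)) 1 := by
  have h : Summable fun n : ℕ => ((n : ℂ) + 1) ^ (-s) := by
    refine ((summable_nat_add_iff 1).mpr (Complex.summable_one_div_nat_cpow.mpr hs)).congr
      fun n => ?_
    rw [Complex.cpow_neg, one_div]
    push_cast
    rfl
  have h' := (hasSum_nat_add_iff' 1).mpr h.hasSum
  have h2 := h.hasSum.sub h'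
  rw [Finset.sum_range_one, Nat.cast_zero, zero_add, Complex.one_cpow, sub_sub_cancel] at h2
  refine h2.congr_fun fun n => ?_
  push_cast
  ring_nf

/-- For Re s > 1 twice this function is Σ ((n+x)^(-s) - (n+1-x)^(-s)). Subtracting 1 - 2x times a
telescoping series of sum 1 leaves second-order terms, summable past s = 0 and all zero there, so
analytic continuation gives 1 - 2x. -/
theorem hurwitzZetaOdd_zero {x : ℝ} (hx0 : 0 < x) (hx1 : x < 1) :
    HurwitzZeta.hurwitzZetaOdd x 0 = 1 / 2 - x := by
  let g : ℕ → ℂ → ℂ := fun n s => ((n + x : ℝ) : ℂ) ^ (-s) - ((n + 1 - x : ℝ) : ℂ) ^ (-s) -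
    ((1 - 2 * x : ℝ) : ℂ) * (((n + 1 : ℝ) : ℂ) ^ (-s) - ((n + 2 : ℝ) : ℂ) ^ (-s))
  -- U contains 0 and a neighbourhood of 2. The half-plane gives the exponent -3/2, and the ball
  -- gives |s||s+1| ≤ 3·4 = 12. The term n = 0 is kept apart, since its interval would start at 0.
  let U : Set ℂ := {s | -(1 / 2) < s.re} ∩ Metric.ball 0 3
  have hUo : IsOpen U := (isOpen_lt continuous_const Complex.continuous_re).inter Metric.isOpen_ball
  have hUc : Convex ℝ U := (convex_halfSpace_re_gt _).inter (convex_ball _ _)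
  have hdiff (n : ℕ) : Differentiable ℂ (g n) := by
    have hc (c : ℝ) (hc : 0 < c) : Differentiable ℂ fun s : ℂ => (c : ℂ) ^ (-s) := fun s =>
      differentiableAt_id.neg.const_cpow (Or.inl (Complex.ofReal_ne_zero.mpr hc.ne'))
    have hn : (0 : ℝ) ≤ n := n.cast_nonneg
    exact ((hc _ (by linarith)).sub (hc _ (by linarith))).sub
      (((hc _ (by linarith)).sub (hc _ (by linarith))).const_mul _)
  have hbound (n : ℕ) (s : ℂ) (hs : s ∈ U) :
      ‖g (n + 1) s‖ ≤ 4 * (12 * ((n + 1 : ℕ) : ℝ) ^ (-(3 / 2) : ℝ)) := by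
    obtain ⟨hs1, hs2⟩ := hs
    rw [Set.mem_ofPred_eq] at hs1
    rw [mem_ball_zero_iff] at hs2
    have hn : (0 : ℝ) ≤ n := n.cast_nonneg
    have hpos (t : ℝ) (ht : t ∈ Set.Icc ((n : ℝ) + 1) (n + 1 + 2)) : 0 < t := by linarith [ht.1]
    have h := norm_sub_sub_mul_sub_le (f := fun t : ℝ => (t : ℂ) ^ (-s))
      (f' := fun t : ℝ => -s * (t : ℂ) ^ (-s - 1))
      (f'' := fun t : ℝ => -s * ((-s - 1) * (t : ℂ) ^ (-s - 1 - 1)))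
      (a := n + 1) (M := 12 * ((n + 1 : ℕ) : ℝ) ^ (-(3 / 2) : ℝ))
      (u := n + 1 + x) (v := n + 1 + 1 - x) (w := n + 1 + 1)
      (fun t ht => hasDerivAt_ofReal_cpow_neg _ (hpos t ht))
      (fun t ht => (hasDerivAt_ofReal_cpow_neg _ (hpos t ht)).const_mul _)
      (fun t ht => ?_) (by constructor <;> linarith) (by constructor <;> linarith)
      (by constructor <;> linarith) (by constructor <;> linarith)
      (by rw [abs_le]; constructor <;> linarith)
    · refine le_of_eq_of_le (congrArg norm ?_) h
      simp only [g]
      push_cast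
      ring_nf
    · rw [norm_mul, norm_mul, norm_neg, Complex.norm_cpow_eq_rpow_re_of_pos (hpos t ht), ← mul_assoc]
      have h1 : ‖-s - 1‖ ≤ 4 := by
        calc ‖-s - 1‖ ≤ ‖-s‖ + ‖(1 : ℂ)‖ := norm_sub_le _ _
          _ ≤ 4 := by rw [norm_neg, norm_one]; linarith
      have h2 : t ^ (-s - 1 - 1).re ≤ ((n + 1 : ℕ) : ℝ) ^ (-(3 / 2) : ℝ) := by
        calc t ^ (-s - 1 - 1).re ≤ t ^ (-(3 / 2) : ℝ) := by
              refine Real.rpow_le_rpow_of_exponent_le (by linarith [ht.1]) ?_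
              simp only [Complex.sub_re, Complex.neg_re, Complex.one_re]
              linarith
          _ ≤ _ := by
              push_cast
              exact Real.rpow_le_rpow_of_nonpos (by linarith) ht.1 (by norm_num)
      have h3 : ‖s‖ * ‖-s - 1‖ ≤ 3 * 4 :=
        mul_le_mul hs2.le h1 (norm_nonneg _) (by norm_num)
      refine mul_le_mul (h3.trans (by norm_num)) h2 (Real.rpow_nonneg (hpos t ht).le _) (by norm_num)
  have hsum : Summable fun n : ℕ => 4 * (12 * ((n + 1 : ℕ) : ℝ) ^ (-(3 / 2) : ℝ)) :=
    (((summable_nat_add_iff 1).mpr (Real.summable_nat_rpow.mpr (by norm_num))).mul_left 12).mul_left 4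
  have hG : DifferentiableOn ℂ (fun s => g 0 s + ∑' n, g (n + 1) s + ((1 - 2 * x : ℝ) : ℂ)) U :=
    ((hdiff 0).differentiableOn.add (Complex.differentiableOn_tsum_of_summable_norm hsum
      (fun n => (hdiff (n + 1)).differentiableOn) hUo hbound)).add_const _
  have hZ : DifferentiableOn ℂ (fun s => 2 * HurwitzZeta.hurwitzZetaOdd x s) U :=
    ((HurwitzZeta.differentiable_hurwitzZetaOdd x).const_mul 2).differentiableOn
  have hlarge (s : ℂ) (hs : 1 < s.re) : 2 * HurwitzZeta.hurwitzZetaOdd x s =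
      g 0 s + ∑' n, g (n + 1) s + ((1 - 2 * x : ℝ) : ℂ) := by
    have h1 := (HurwitzZeta.hasSum_nat_hurwitzZetaOdd_of_mem_Icc ⟨hx0.le, hx1.le⟩ hs).mul_left 2
    have h2 := (hasSum_cpow_sub_cpow hs).mul_left ((1 - 2 * x : ℝ) : ℂ)
    have h3 : HasSum (fun n => g n s) _ := (h1.sub h2).congr_fun fun n => by
      simp only [g, Complex.cpow_neg]
      push_cast
      ring
    rw [← h3.summable.tsum_eq_zero_add, h3.tsum_eq]
    ring
  have h2U : (2 : ℂ) ∈ U := by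
    constructor
    · norm_num
    · rw [mem_ball_zero_iff]
      norm_num
  have heq := (hZ.analyticOnNhd hUo).eqOn_of_preconnected_of_eventuallyEq (hG.analyticOnNhd hUo)
    hUc.isPreconnected h2U (by
      filter_upwards [(isOpen_lt continuous_const Complex.continuous_re).mem_nhds
        (show (1 : ℝ) < (2 : ℂ).re by norm_num)] with s hs using hlarge s hs)
  have h0U : (0 : ℂ) ∈ U := by
    constructor
    · norm_num
    · simp
  have h0 := heq h0U
  have hg0 (n : ℕ) : g n 0 = 0 := by simp [g]
  simp only [hg0, tsum_zero, add_zero, zero_add] at h0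
  push_cast at h0
  linear_combination h0 / 2

/-- The value at zero of the `L`-function of an odd Dirichlet character. -/
theorem LFunction_zero_of_odd {N : ℕ} [NeZero N] (hN : 1 < N) {χ : DirichletCharacter ℂ N}
    (hχ : χ.Odd) : χ.LFunction 0 = -(1 / N) * ∑ j : ZMod N, χ j * (j.val : ℂ) := by
  have hN0 : (N : ℝ) ≠ 0 := Nat.cast_ne_zero.mpr (NeZero.ne N)
  have hNC : (N : ℂ) ≠ 0 := Nat.cast_ne_zero.mpr (NeZero.ne N)
  have : Fact (1 < N) := ⟨hN⟩
  have hodd : Function.Odd χ := hχ.to_fun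
  -- This removes the constant 1/2 from the Hurwitz value 1/2 - j/N.
  have hsum : ∑ j : ZMod N, χ j = 0 := by
    have h : ∑ j : ZMod N, χ j = -∑ j : ZMod N, χ j := by
      rw [← Finset.sum_neg_distrib]
      exact Fintype.sum_equiv (.neg _) _ _ fun i => by simp [hodd i]
    exact self_eq_neg.mp h
  have hterm (j : ZMod N) : χ j * HurwitzZeta.hurwitzZetaOdd (ZMod.toAddCircle j) 0 =
      1 / 2 * χ j - 1 / N * (χ j * (j.val : ℂ)) := by
    rcases eq_or_ne j 0 with rfl | hj
    · rw [MulChar.map_zero]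
      simp
    · rw [ZMod.toAddCircle_apply, hurwitzZetaOdd_zero]
      · push_cast
        ring
      · have : 0 < j.val := Nat.pos_of_ne_zero ((ZMod.val_ne_zero j).mpr hj)
        have := NeZero.pos N
        positivity
      · rw [div_lt_one (by have := NeZero.pos N; positivity)]
        exact_mod_cast j.val_lt
  rw [DirichletCharacter.LFunction, ZMod.LFunction_def_odd hodd, neg_zero, Complex.cpow_zero,
    one_mul, Finset.sum_congr rfl fun j _ => hterm j, Finset.sum_sub_distrib, ← Finset.mul_sum,
    ← Finset.mul_sum, hsum]
  ring

/-! ### Averaging the Eisenstein series over the odd characters -/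

theorem isPrimitive_of_odd_of_prime {p : ℕ} (hp : p.Prime) {χ : DirichletCharacter ℂ p}
    (hχ : χ.Odd) : χ.IsPrimitive := by
  rcases (Nat.dvd_prime hp).mp (DirichletCharacter.conductor_dvd_level χ) with h | h
  · have : NeZero p := ⟨hp.ne_zero⟩
    rw [← DirichletCharacter.eq_one_iff_conductor_eq_one] at h
    have h1 : χ (-1) = -1 := hχ
    rw [h, MulChar.one_apply isUnit_one.neg] at h1
    norm_num at h1
  · exact h

open scoped Classical in
-- (χ(j) - χ(-j))/2 is χ(j) for odd χ and 0 for even χ, so orthogonality over all characters applies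
-- twice.
theorem sum_odd_inv_mul {p : ℕ} [Fact p.Prime] {a : ZMod p} (ha : a ≠ 0) (j : ZMod p) :
    ∑ χ : DirichletCharacter ℂ p with χ.Odd, χ a⁻¹ * χ j =
      ((p : ℂ) - 1) / 2 * ((if a = j then 1 else 0) - if a = -j then 1 else 0) := by
  have hu : IsUnit a := ha.isUnit
  have h1 := DirichletCharacter.sum_char_inv_mul_char_eq ℂ hu j
  have h2 := DirichletCharacter.sum_char_inv_mul_char_eq ℂ hu (-j)
  have hp := (Fact.out : p.Prime)
  have htot : ((p.totient : ℕ) : ℂ) = p - 1 := by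
    rw [Nat.totient_prime hp, Nat.cast_sub hp.one_lt.le, Nat.cast_one]
  rw [htot] at h1 h2
  have h3 : ∑ χ : DirichletCharacter ℂ p with χ.Odd, χ a⁻¹ * χ j =
      (∑ χ : DirichletCharacter ℂ p, χ a⁻¹ * χ j -
        ∑ χ : DirichletCharacter ℂ p, χ a⁻¹ * χ (-j)) / 2 := by
    rw [Finset.sum_filter, ← Finset.sum_sub_distrib, Finset.sum_div]
    refine Finset.sum_congr rfl fun χ _ => ?_
    split_ifs with h
    · rw [h.eval_neg]
      ring
    · rw [(χ.even_or_odd.resolve_right h).eval_neg]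
      ring
  rw [h3, h1, h2]
  split_ifs <;> ring

/-- `⟨a m⟩ + ⟨b m⟩ + ⟨c m⟩ - ⟨(a + b + c) m⟩`, with least nonnegative residues modulo `p`. -/
def residueDefect {p : ℕ} (a b c m : ZMod p) : ℤ :=
  (a * m).val + (b * m).val + (c * m).val - ((a + b + c) * m).val

/-- The odd part of `residueDefect a b c` is `-p` times the odd part of the indicator function
of `1`. -/
def HasUnitOddDefect {p : ℕ} (a b c : ZMod p) : Prop :=
  ∀ m : ZMod p, residueDefect a b c m - residueDefect a b c (-m) =
    -2 * p * ((if m = 1 then 1 else 0) - if m = -1 then 1 else 0)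

/-- With S = Σ χ(j)⟨j⟩, multiplying by χ(e⁻¹) gives Σ χ(m)⟨em⟩. The four-term combination times S is
therefore Σ χ(m) `residueDefect`(m); χ sees only the odd part, so this is -2p, while L(0,χ) = -S/p.
-/
theorem two_div_LFunction_zero {p : ℕ} [Fact p.Prime] {a b c : ZMod p} (ha : a ≠ 0) (hb : b ≠ 0)
    (hc : c ≠ 0) (hd : a + b + c ≠ 0)
    (hr : HasUnitOddDefect a b c)
    {χ : DirichletCharacter ℂ p} (hχ : χ.Odd) :
    2 / χ.LFunction 0 = χ a⁻¹ + χ b⁻¹ + χ c⁻¹ - χ (a + b + c)⁻¹ := by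
  have hp := (Fact.out : p.Prime)
  have hp0 : (p : ℂ) ≠ 0 := Nat.cast_ne_zero.mpr hp.ne_zero
  have hL : χ.LFunction 0 ≠ 0 := by
    simpa using LFunction_zero_ne_zero χ hχ (isPrimitive_of_odd_of_prime hp hχ)
  have hscale (e : ZMod p) (he : e ≠ 0) : (∑ j : ZMod p, χ j * (j.val : ℂ)) * χ e⁻¹ =
      ∑ m : ZMod p, χ m * ((e * m).val : ℂ) := by
    rw [Finset.sum_mul]
    symm
    refine Fintype.sum_equiv (Equiv.mulLeft₀ e he) _ _ fun m => ?_
    have h : χ e * χ e⁻¹ = 1 := by rw [← map_mul, mul_inv_cancel₀ he, map_one]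
    rw [show Equiv.mulLeft₀ e he m = e * m from rfl, map_mul]
    linear_combination -(χ m * ((e * m).val : ℂ)) * h
  have h1 : (∑ j : ZMod p, χ j * (j.val : ℂ)) * (χ a⁻¹ + χ b⁻¹ + χ c⁻¹ - χ (a + b + c)⁻¹) =
      ∑ m : ZMod p, χ m * (residueDefect a b c m : ℂ) := by
    rw [mul_sub, mul_add, mul_add, hscale a ha, hscale b hb, hscale c hc, hscale _ hd,
      ← Finset.sum_add_distrib, ← Finset.sum_add_distrib, ← Finset.sum_sub_distrib]
    refine Finset.sum_congr rfl fun m _ => ?_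
    rw [residueDefect]
    push_cast
    ring
  have h2 : ∑ m : ZMod p, χ m * (residueDefect a b c m : ℂ) =
      -∑ m : ZMod p, χ m * (residueDefect a b c (-m) : ℂ) := by
    rw [← Finset.sum_neg_distrib]
    refine Fintype.sum_equiv (.neg _) _ _ fun m => ?_
    simp [hχ.eval_neg]
  have h3 : ∑ m : ZMod p, χ m * (residueDefect a b c m : ℂ) -
      ∑ m : ZMod p, χ m * (residueDefect a b c (-m) : ℂ) = -4 * p := by
    rw [← Finset.sum_sub_distrib]
    have h4 (m : ZMod p) : χ m * (residueDefect a b c m : ℂ) -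
        χ m * (residueDefect a b c (-m) : ℂ) =
        -2 * p * ((if m = 1 then χ m else 0) - if m = -1 then χ m else 0) := by
      rw [← mul_sub, ← Int.cast_sub, hr]
      push_cast
      split_ifs <;> ring
    rw [Finset.sum_congr rfl fun m _ => h4 m, ← Finset.mul_sum, Finset.sum_sub_distrib,
      Finset.sum_ite_eq' Finset.univ (1 : ZMod p), Finset.sum_ite_eq' Finset.univ (-1 : ZMod p)]
    have h5 : χ (-1) = -1 := hχ
    simp only [Finset.mem_univ, if_true, map_one, h5]
    ring
  rw [div_eq_iff hL, LFunction_zero_of_odd hp.one_lt hχ]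
  have h6 : ∑ m : ZMod p, χ m * (residueDefect a b c m : ℂ) = -2 * p := by
    linear_combination (h3 + h2) / 2
  rw [h6] at h1
  rw [mul_comm, mul_assoc, h1]
  field_simp

/-- The part of the Lambert series `∑ q ^ n / (1 - q ^ n)` with `n` in a residue class. -/
def lambertClass {p : ℕ} (q : ℂ) (j : ZMod p) : ℂ :=
  ∑' n : ℕ+, if ((n : ℕ) : ZMod p) = j then q ^ (n : ℕ) / (1 - q ^ (n : ℕ)) else 0

theorem summable_lambert_pnat {q : ℂ} (hq : ‖q‖ < 1) :
    Summable fun n : ℕ+ => ‖q ^ (n : ℕ) / (1 - q ^ (n : ℕ))‖ := by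
  simpa using ((summable_norm_pow_mul_geometric_div_one_sub 0 hq).comp_injective
    PNat.coe_injective).norm

theorem summable_lambertClass {p : ℕ} {q : ℂ} (hq : ‖q‖ < 1) (j : ZMod p) :
    Summable fun n : ℕ+ =>
      if ((n : ℕ) : ZMod p) = j then q ^ (n : ℕ) / (1 - q ^ (n : ℕ)) else 0 := by
  refine Summable.of_norm_bounded (summable_lambert_pnat hq) fun n => ?_
  split_ifs
  · exact le_rfl
  · rw [norm_zero]
    exact norm_nonneg _

theorem eisenstein_one {p : ℕ} [NeZero p] (χ : DirichletCharacter ℂ p) (τ : ℍ) :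
    eisenstein χ 1 τ =
      1 + 2 / χ.LFunction 0 * ∑ j : ZMod p, χ j * lambertClass (nome τ) j := by
  have hq := norm_nome_lt_one τ
  have h : ∑ j : ZMod p, χ j * lambertClass (nome τ) j =
      ∑' n : ℕ+, χ ((n : ℕ) : ZMod p) *
        (((n : ℕ) : ℂ) ^ (1 - 1) * nome τ ^ (n : ℕ) / (1 - nome τ ^ (n : ℕ))) := by
    simp only [lambertClass, ← tsum_mul_left]
    rw [← Summable.tsum_finsetSum fun j _ => (summable_lambertClass hq j).mul_left _]
    refine tsum_congr fun n => ?_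
    simp
  rw [h, eisenstein, Nat.cast_one, sub_self]

theorem eisensteinSum_eq_lambertClass {p : ℕ} [Fact p.Prime] {a b c : ZMod p} (h2 : 2 < p)
    (ha : a ≠ 0) (hb : b ≠ 0) (hc : c ≠ 0) (hd : a + b + c ≠ 0)
    (hr : HasUnitOddDefect a b c) (τ : ℍ) :
    eisensteinSum p τ = 1 + (lambertClass (nome τ) a - lambertClass (nome τ) (-a)) +
      (lambertClass (nome τ) b - lambertClass (nome τ) (-b)) +
      (lambertClass (nome τ) c - lambertClass (nome τ) (-c)) -
      (lambertClass (nome τ) (a + b + c) - lambertClass (nome τ) (-(a + b + c))) := by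
  classical
  have hp := (Fact.out : p.Prime)
  have hp1 : (p : ℂ) - 1 ≠ 0 := by
    rw [sub_ne_zero]
    exact_mod_cast hp.one_lt.ne'
  have hfilter : (Finset.univ.filter fun χ : DirichletCharacter ℂ p => χ.Odd ∧ χ.IsPrimitive) =
      Finset.univ.filter fun χ : DirichletCharacter ℂ p => χ.Odd :=
    Finset.filter_congr fun χ _ => and_iff_left_of_imp (isPrimitive_of_odd_of_prime hp)
  have hne : (1 : ZMod p) ≠ -1 := by
    have : Fact (2 < p) := ⟨h2⟩
    exact (ZMod.neg_one_ne_one).symm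
  -- The number of odd characters is orthogonality at a = j = 1; p > 2 is needed for 1 ≠ -1.
  have hone : ∑ χ : DirichletCharacter ℂ p with χ.Odd, (1 : ℂ) = ((p : ℂ) - 1) / 2 := by
    have h := sum_odd_inv_mul (p := p) (a := 1) one_ne_zero 1
    simpa [hne] using h
  have hsum (e : ZMod p) (he : e ≠ 0) : ∑ χ : DirichletCharacter ℂ p with χ.Odd,
      χ e⁻¹ * ∑ j : ZMod p, χ j * lambertClass (nome τ) j =
      ((p : ℂ) - 1) / 2 * (lambertClass (nome τ) e - lambertClass (nome τ) (-e)) := by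
    simp only [Finset.mul_sum]
    rw [Finset.sum_comm]
    simp only [← mul_assoc, ← Finset.sum_mul]
    simp only [sum_odd_inv_mul he, mul_assoc, ← Finset.mul_sum, sub_mul, ite_mul, one_mul, zero_mul,
      Finset.sum_sub_distrib, Finset.sum_ite_eq, eq_neg_iff_add_eq_zero, add_comm e]
    simp [← eq_neg_iff_add_eq_zero]
  have hmain : ∑ χ : DirichletCharacter ℂ p with χ.Odd, eisenstein χ 1 τ =
      ∑ χ : DirichletCharacter ℂ p with χ.Odd, ((1 : ℂ) +
        χ a⁻¹ * (∑ j : ZMod p, χ j * lambertClass (nome τ) j) +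
        χ b⁻¹ * (∑ j : ZMod p, χ j * lambertClass (nome τ) j) +
        χ c⁻¹ * (∑ j : ZMod p, χ j * lambertClass (nome τ) j) -
        χ (a + b + c)⁻¹ * (∑ j : ZMod p, χ j * lambertClass (nome τ) j)) := by
    refine Finset.sum_congr rfl fun χ hχ => ?_
    rw [eisenstein_one, two_div_LFunction_zero ha hb hc hd hr (Finset.mem_filter.mp hχ).2]
    ring
  have hdef : eisensteinSum p τ = 2 / ((p : ℂ) - 1) *
      ∑ χ : DirichletCharacter ℂ p with χ.Odd, eisenstein χ 1 τ := by
    rw [eisensteinSum, ← hfilter]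
  rw [hdef, hmain, Finset.sum_sub_distrib, Finset.sum_add_distrib, Finset.sum_add_distrib,
    Finset.sum_add_distrib, hone, hsum a ha, hsum b hb, hsum c hc, hsum _ hd]
  field_simp

/-! ### Specialization to Q = q^p at powers of q -/

theorem lambertClass_natCast {p k : ℕ} (hk0 : 0 < k) (hkp : k < p) (q : ℂ) :
    lambertClass q (k : ZMod p) = ∑' m : ℕ, q ^ k * (q ^ p) ^ m / (1 - q ^ k * (q ^ p) ^ m) := by
  let i : ℕ → ℕ+ := fun m => ⟨k + p * m, by positivity⟩
  have hp : 0 < p := hk0.trans hkp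
  have hi : Function.Injective i := by
    intro m n h
    have h1 : k + p * m = k + p * n := congrArg PNat.val h
    exact Nat.eq_of_mul_eq_mul_left hp (Nat.add_left_cancel h1)
  rw [lambertClass, ← hi.tsum_eq]
  · refine tsum_congr fun m => ?_
    simp [i, pow_add, pow_mul]
  · intro n hn
    rw [Function.mem_support, ne_eq, ite_eq_right_iff, not_forall] at hn
    obtain ⟨h1, -⟩ := hn
    rw [ZMod.natCast_eq_natCast_iff', Nat.mod_eq_of_lt hkp] at h1
    refine ⟨(n : ℕ) / p, PNat.eq ?_⟩
    change k + p * ((n : ℕ) / p) = n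
    rw [← h1]
    exact Nat.mod_add_div _ _

theorem norm_pow_lt_norm_pow {q : ℂ} (hq0 : q ≠ 0) (hq : ‖q‖ < 1) {m n : ℕ} (h : m < n) :
    ‖q ^ n‖ < ‖q ^ m‖ := by
  rw [norm_pow, norm_pow]
  exact pow_lt_pow_right_of_lt_one₀ (norm_pos_iff.mpr hq0) hq h

theorem norm_pow_lt_one {q : ℂ} (hq : ‖q‖ < 1) {n : ℕ} (h : 0 < n) : ‖q ^ n‖ < 1 := by
  rw [norm_pow]
  exact pow_lt_one₀ (norm_nonneg q) hq h.ne'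

theorem lambert_eq_lambertClass {p k : ℕ} (hk0 : 0 < k) (hkp : k < p) {q : ℂ} (hq0 : q ≠ 0)
    (hq : ‖q‖ < 1) : lambert (q ^ p) (q ^ k) =
      lambertClass q (k : ZMod p) - lambertClass q (-(k : ZMod p)) := by
  have hQ := norm_pow_lt_one hq (hk0.trans hkp)
  have hneg : -(k : ZMod p) = ((p - k : ℕ) : ZMod p) := by
    rw [Nat.cast_sub hkp.le, ZMod.natCast_self, zero_sub]
  rw [lambert, (hasSum_lambertTerm (pow_ne_zero p hq0) hQ (pow_ne_zero k hq0)
    (one_sub_mul_zpow_ne_zero hQ (norm_pow_lt_norm_pow hq0 hq hkp)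
      (norm_pow_lt_one hq hk0))).tsum_eq, hneg, lambertClass_natCast hk0 hkp,
    lambertClass_natCast (Nat.sub_pos_of_lt hkp) (Nat.sub_lt (hk0.trans hkp) hk0)]
  congr 1
  refine tsum_congr fun m => ?_
  have h : (q ^ p) ^ (m + 1) / q ^ k = q ^ (p - k) * (q ^ p) ^ m := by
    rw [div_eq_iff (pow_ne_zero k hq0), mul_right_comm, ← pow_add, Nat.sub_add_cancel hkp.le,
      pow_succ']
  rw [h]

/-- The product `(q ^ k, q ^ (p - k); q ^ p)_∞`. -/
theorem theta_pow {p k : ℕ} (hkp : k ≤ p) {q : ℂ} (hq0 : q ≠ 0) :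
    theta (q ^ p) (q ^ k) = qPoch (q ^ k) (q ^ p) * qPoch (q ^ (p - k)) (q ^ p) := by
  rw [theta, div_eq_mul_inv, pow_sub₀ q hq0 hkp]

theorem theta_pow_ne_zero {p k : ℕ} (hk0 : 0 < k) (hkp : k < p) {q : ℂ} (hq0 : q ≠ 0)
    (hq : ‖q‖ < 1) : theta (q ^ p) (q ^ k) ≠ 0 := by
  have hQ := norm_pow_lt_one hq (hk0.trans hkp)
  exact theta_ne_zero hQ (pow_ne_zero k hq0)
    (one_sub_mul_zpow_ne_zero hQ (norm_pow_lt_norm_pow hq0 hq hkp) (norm_pow_lt_one hq hk0))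

theorem theta_pow_sub {p k l : ℕ} (h : k + l = p) {q : ℂ} (hq0 : q ≠ 0) :
    theta (q ^ p) (q ^ k) = theta (q ^ p) (q ^ l) := by
  rw [theta_pow (by lia) hq0, theta_pow (by lia) hq0, show p - k = l by lia,
    show p - l = k by lia, mul_comm]

theorem nome_ne_zero (τ : ℍ) : nome τ ≠ 0 := Complex.exp_ne_zero _

/-- The averaged Eisenstein series as a product of theta functions. -/
theorem eisensteinSum_mul_theta {p : ℕ} [Fact p.Prime] (h2 : 2 < p) {a b c : ℕ} (ha : 0 < a)
    (hb : 0 < b) (hc : 0 < c) (hd : a + b + c < p)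
    (hr : HasUnitOddDefect (a : ZMod p) b c) (τ : ℍ) {q : ℂ}
    (hq : q = nome τ) :
    eisensteinSum p τ * (theta (q ^ p) (q ^ a) * theta (q ^ p) (q ^ b) * theta (q ^ p) (q ^ c) *
        theta (q ^ p) (q ^ (a + b + c))) =
      qPoch (q ^ p) (q ^ p) ^ 2 * theta (q ^ p) (q ^ (a + b)) * theta (q ^ p) (q ^ (b + c)) *
        theta (q ^ p) (q ^ (a + c)) := by
  have hq0 : q ≠ 0 := hq ▸ nome_ne_zero τ
  have hq1 : ‖q‖ < 1 := hq ▸ norm_nome_lt_one τ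
  have hne {k : ℕ} (hk : 0 < k) (hkp : k < p) : (k : ZMod p) ≠ 0 := by
    rw [ne_eq, ZMod.natCast_eq_zero_iff]
    exact Nat.not_dvd_of_pos_of_lt hk hkp
  have h := theta_product_eq_lambert (pow_ne_zero p hq0) (norm_pow_lt_one hq1 (by lia))
    (norm_pow_lt_one hq1 ha) (norm_pow_lt_one hq1 hb) (norm_pow_lt_one hq1 hc)
    (by rw [← pow_add, ← pow_add]; exact norm_pow_lt_norm_pow hq0 hq1 hd)
  have hE := eisensteinSum_eq_lambertClass h2 (hne ha (by lia)) (hne hb (by lia))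
    (hne hc (by lia)) (by simpa using hne (k := a + b + c) (by lia) hd) hr τ
  have hS {k : ℕ} (hk : 0 < k) (hkp : k < p) := lambert_eq_lambertClass hk hkp hq0 hq1
  rw [← pow_add, ← pow_add, ← pow_add, ← pow_add, hS ha (by lia), hS hb (by lia), hS hc (by lia),
    hS (k := a + b + c) (by lia) hd, Nat.cast_add, Nat.cast_add] at h
  rw [hE, ← hq, h]

theorem theta_pow_one {p : ℕ} (hp : 1 ≤ p) {q : ℂ} (hq0 : q ≠ 0) :
    theta (q ^ p) q = qPoch q (q ^ p) * qPoch (q ^ (p - 1)) (q ^ p) := by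
  simpa using theta_pow hp hq0

/-! ### The six primes -/

theorem qPoch_self_eq_mul {q : ℂ} (hq : ‖q‖ < 1) : qPoch q q =
    qPoch q (q ^ 5) * qPoch (q ^ 2) (q ^ 5) * qPoch (q ^ 3) (q ^ 5) * qPoch (q ^ 4) (q ^ 5) *
      qPoch (q ^ 5) (q ^ 5) := by
  have hQ : ‖q ^ 5‖ < 1 := norm_pow_lt_one hq (by norm_num)
  have h (n : ℕ) : (∏ k ∈ Finset.range (n * 5), (1 - q * q ^ k)) =
      (∏ k ∈ Finset.range n, (1 - q * (q ^ 5) ^ k)) *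
      (∏ k ∈ Finset.range n, (1 - q ^ 2 * (q ^ 5) ^ k)) *
      (∏ k ∈ Finset.range n, (1 - q ^ 3 * (q ^ 5) ^ k)) *
      (∏ k ∈ Finset.range n, (1 - q ^ 4 * (q ^ 5) ^ k)) *
      ∏ k ∈ Finset.range n, (1 - q ^ 5 * (q ^ 5) ^ k) := by
    induction n with
    | zero => simp
    | succ n ih =>
      rw [Nat.succ_mul, Finset.prod_range_add, ih]
      simp only [Finset.prod_range_succ, Finset.prod_range_zero, pow_zero,
        pow_succ, mul_comm n 5]
      ring
  have h1 := (tendsto_prod_qPoch q hq).comp (tendsto_id.atTop_mul_const' (r := 5) (by norm_num))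
  refine tendsto_nhds_unique (h1.congr h) ?_
  exact ((((tendsto_prod_qPoch q hQ).mul (tendsto_prod_qPoch _ hQ)).mul
    (tendsto_prod_qPoch _ hQ)).mul (tendsto_prod_qPoch _ hQ)).mul (tendsto_prod_qPoch _ hQ)

theorem eisensteinSum_five (τ : ℍ) {q : ℂ} (hq : q = nome τ) :
    eisensteinSum 5 τ = qPoch q q ^ 2 / qPochs [q, q ^ 4] (q ^ 5) ^ 5 := by
  have hq0 : q ≠ 0 := hq ▸ nome_ne_zero τ
  have hq1 : ‖q‖ < 1 := hq ▸ norm_nome_lt_one τ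
  -- With θ_k = θ(q^k) and θ_3 = θ_2, the triple (1,1,1) gives E θ_1³ = (q⁵;q⁵)² θ_2²; multiplying
  -- by θ_1² makes the right side (q;q)².
  have hr : HasUnitOddDefect ((1 : ℕ) : ZMod 5) (1 : ℕ) (1 : ℕ) := by
    unfold HasUnitOddDefect
    decide
  have : Fact (Nat.Prime 5) := ⟨by norm_num⟩
  have h := eisensteinSum_mul_theta (p := 5) (a := 1) (b := 1) (c := 1) (by norm_num) (by norm_num)
    (by norm_num) (by norm_num) (by norm_num) hr τ hq
  norm_num only at h
  have n1 := theta_pow_ne_zero (p := 5) (k := 1) (by norm_num) (by norm_num) hq0 hq1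
  have n2 := theta_pow_ne_zero (p := 5) (k := 2) (by norm_num) (by norm_num) hq0 hq1
  rw [theta_pow_sub (p := 5) (k := 3) (l := 2) (by norm_num) hq0] at h
  have t1 := theta_pow_one (p := 5) (by norm_num) hq0
  have t2 := theta_pow (p := 5) (k := 2) (by norm_num) hq0
  norm_num only [pow_one] at t1 t2 h n1
  have e1 : qPochs [q, q ^ 4] (q ^ 5) = theta (q ^ 5) q := by
    simp [qPochs, t1]
  rw [e1, qPoch_self_eq_mul hq1, eq_div_iff (pow_ne_zero 5 n1)]
  refine mul_right_cancel₀ n2 ?_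
  rw [t1, t2] at h ⊢
  linear_combination (qPoch q (q ^ 5) * qPoch (q ^ 4) (q ^ 5)) ^ 2 * h

theorem eisensteinSum_seven (τ : ℍ) {q : ℂ} (hq : q = nome τ) :
    eisensteinSum 7 τ =
      qPochs [q ^ 3, q ^ 4, q ^ 7, q ^ 7] (q ^ 7) / qPochs [q, q ^ 6] (q ^ 7) ^ 2 := by
  have hq0 : q ≠ 0 := hq ▸ nome_ne_zero τ
  have hq1 : ‖q‖ < 1 := hq ▸ norm_nome_lt_one τ
  -- The triple is chosen so that θ_2 and θ_4 = θ_3 cancel.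
  have hr : HasUnitOddDefect ((1 : ℕ) : ZMod 7) (1 : ℕ) (2 : ℕ) := by
    unfold HasUnitOddDefect
    decide
  have : Fact (Nat.Prime 7) := ⟨by norm_num⟩
  have h := eisensteinSum_mul_theta (p := 7) (a := 1) (b := 1) (c := 2) (by norm_num) (by norm_num)
    (by norm_num) (by norm_num) (by norm_num) hr τ hq
  norm_num only at h
  have n1 := theta_pow_ne_zero (p := 7) (k := 1) (by norm_num) (by norm_num) hq0 hq1
  have n2 := theta_pow_ne_zero (p := 7) (k := 2) (by norm_num) (by norm_num) hq0 hq1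
  have n3 := theta_pow_ne_zero (p := 7) (k := 3) (by norm_num) (by norm_num) hq0 hq1
  rw [theta_pow_sub (p := 7) (k := 4) (l := 3) (by norm_num) hq0] at h
  have e1 : qPochs [q, q ^ 6] (q ^ 7) = theta (q ^ 7) (q ^ 1) := by
    simp [qPochs, theta_pow_one (p := 7) (by norm_num) hq0]
  have e2 : qPochs [q ^ 3, q ^ 4, q ^ 7, q ^ 7] (q ^ 7) =
      theta (q ^ 7) (q ^ 3) * qPoch (q ^ 7) (q ^ 7) ^ 2 := by
    simp [qPochs, theta_pow (p := 7) (k := 3) (by norm_num) hq0]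
    ring
  rw [e1, e2, eq_div_iff (pow_ne_zero 2 n1)]
  refine mul_right_cancel₀ (mul_ne_zero n2 n3) ?_
  linear_combination h

theorem eisensteinSum_eleven (τ : ℍ) {q : ℂ} (hq : q = nome τ) :
    eisensteinSum 11 τ = qPochs [q ^ 4, q ^ 7, q ^ 11, q ^ 11] (q ^ 11) /
      qPochs [q, q ^ 10, q ^ 2, q ^ 9] (q ^ 11) := by
  have hq0 : q ≠ 0 := hq ▸ nome_ne_zero τ
  have hq1 : ‖q‖ < 1 := hq ▸ norm_nome_lt_one τ
  -- Here θ_3 and θ_6 = θ_5 cancel.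
  have hr : HasUnitOddDefect ((1 : ℕ) : ZMod 11) (2 : ℕ) (3 : ℕ) := by
    unfold HasUnitOddDefect
    decide
  have : Fact (Nat.Prime 11) := ⟨by norm_num⟩
  have h := eisensteinSum_mul_theta (p := 11) (a := 1) (b := 2) (c := 3) (by norm_num)
    (by norm_num) (by norm_num) (by norm_num) (by norm_num) hr τ hq
  norm_num only at h
  have hn (k : ℕ) (hk : 0 < k) (hkp : k < 11) := theta_pow_ne_zero hk hkp hq0 hq1
  have n1 := hn 1 (by norm_num) (by norm_num)
  have n2 := hn 2 (by norm_num) (by norm_num)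
  have n3 := hn 3 (by norm_num) (by norm_num)
  have n5 := hn 5 (by norm_num) (by norm_num)
  rw [theta_pow_sub (p := 11) (k := 6) (l := 5) (by norm_num) hq0] at h
  have e1 : qPochs [q, q ^ 10, q ^ 2, q ^ 9] (q ^ 11) =
      theta (q ^ 11) (q ^ 1) * theta (q ^ 11) (q ^ 2) := by
    simp [qPochs, theta_pow_one (p := 11) (by norm_num) hq0,
      theta_pow (p := 11) (k := 2) (by norm_num) hq0]
    ring
  have e2 : qPochs [q ^ 4, q ^ 7, q ^ 11, q ^ 11] (q ^ 11) =
      theta (q ^ 11) (q ^ 4) * qPoch (q ^ 11) (q ^ 11) ^ 2 := by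
    simp [qPochs, theta_pow (p := 11) (k := 4) (by norm_num) hq0]
    ring
  rw [e1, e2, eq_div_iff (mul_ne_zero n1 n2)]
  refine mul_right_cancel₀ (mul_ne_zero n3 n5) ?_
  linear_combination h

theorem eisensteinSum_thirteen (τ : ℍ) {q : ℂ} (hq : q = nome τ) :
    eisensteinSum 13 τ = qPochs [q ^ 6, q ^ 7, q ^ 13, q ^ 13] (q ^ 13) /
      qPochs [q, q ^ 12, q ^ 3, q ^ 10] (q ^ 13) := by
  have hq0 : q ≠ 0 := hq ▸ nome_ne_zero τ
  have hq1 : ‖q‖ < 1 := hq ▸ norm_nome_lt_one τ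
  -- Here θ_4 and θ_8 = θ_5 cancel, and θ_7 = θ_6 remains.
  have hr : HasUnitOddDefect ((1 : ℕ) : ZMod 13) (3 : ℕ) (4 : ℕ) := by
    unfold HasUnitOddDefect
    decide
  have : Fact (Nat.Prime 13) := ⟨by norm_num⟩
  have h := eisensteinSum_mul_theta (p := 13) (a := 1) (b := 3) (c := 4) (by norm_num)
    (by norm_num) (by norm_num) (by norm_num) (by norm_num) hr τ hq
  norm_num only at h
  have hn (k : ℕ) (hk : 0 < k) (hkp : k < 13) := theta_pow_ne_zero hk hkp hq0 hq1
  have n1 := hn 1 (by norm_num) (by norm_num)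
  have n3 := hn 3 (by norm_num) (by norm_num)
  have n4 := hn 4 (by norm_num) (by norm_num)
  have n5 := hn 5 (by norm_num) (by norm_num)
  rw [theta_pow_sub (p := 13) (k := 8) (l := 5) (by norm_num) hq0,
    theta_pow_sub (p := 13) (k := 7) (l := 6) (by norm_num) hq0] at h
  have e1 : qPochs [q, q ^ 12, q ^ 3, q ^ 10] (q ^ 13) =
      theta (q ^ 13) (q ^ 1) * theta (q ^ 13) (q ^ 3) := by
    simp [qPochs, theta_pow_one (p := 13) (by norm_num) hq0,
      theta_pow (p := 13) (k := 3) (by norm_num) hq0]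
    ring
  have e2 : qPochs [q ^ 6, q ^ 7, q ^ 13, q ^ 13] (q ^ 13) =
      theta (q ^ 13) (q ^ 6) * qPoch (q ^ 13) (q ^ 13) ^ 2 := by
    simp [qPochs, theta_pow (p := 13) (k := 6) (by norm_num) hq0]
    ring
  rw [e1, e2, eq_div_iff (mul_ne_zero n1 n3)]
  refine mul_right_cancel₀ (mul_ne_zero n4 n5) ?_
  linear_combination h

theorem eisensteinSum_seventeen (τ : ℍ) {q : ℂ} (hq : q = nome τ) :
    eisensteinSum 17 τ = qPochs [q ^ 8, q ^ 9, q ^ 17, q ^ 17] (q ^ 17) /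
      qPochs [q ^ 2, q ^ 15, q ^ 3, q ^ 14] (q ^ 17) := by
  have hq0 : q ≠ 0 := hq ▸ nome_ne_zero τ
  have hq1 : ‖q‖ < 1 := hq ▸ norm_nome_lt_one τ
  -- Here θ_5 and θ_10 = θ_7 cancel.
  have hr : HasUnitOddDefect ((2 : ℕ) : ZMod 17) (3 : ℕ) (5 : ℕ) := by
    unfold HasUnitOddDefect
    decide
  have : Fact (Nat.Prime 17) := ⟨by norm_num⟩
  have h := eisensteinSum_mul_theta (p := 17) (a := 2) (b := 3) (c := 5) (by norm_num)
    (by norm_num) (by norm_num) (by norm_num) (by norm_num) hr τ hq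
  norm_num only at h
  have hn (k : ℕ) (hk : 0 < k) (hkp : k < 17) := theta_pow_ne_zero hk hkp hq0 hq1
  have n2 := hn 2 (by norm_num) (by norm_num)
  have n3 := hn 3 (by norm_num) (by norm_num)
  have n5 := hn 5 (by norm_num) (by norm_num)
  have n7 := hn 7 (by norm_num) (by norm_num)
  rw [theta_pow_sub (p := 17) (k := 10) (l := 7) (by norm_num) hq0] at h
  have e1 : qPochs [q ^ 2, q ^ 15, q ^ 3, q ^ 14] (q ^ 17) =
      theta (q ^ 17) (q ^ 2) * theta (q ^ 17) (q ^ 3) := by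
    simp [qPochs, theta_pow (p := 17) (k := 2) (by norm_num) hq0,
      theta_pow (p := 17) (k := 3) (by norm_num) hq0]
    ring
  have e2 : qPochs [q ^ 8, q ^ 9, q ^ 17, q ^ 17] (q ^ 17) =
      theta (q ^ 17) (q ^ 8) * qPoch (q ^ 17) (q ^ 17) ^ 2 := by
    simp [qPochs, theta_pow (p := 17) (k := 8) (by norm_num) hq0]
    ring
  rw [e1, e2, eq_div_iff (mul_ne_zero n2 n3)]
  refine mul_right_cancel₀ (mul_ne_zero n5 n7) ?_
  linear_combination h

theorem eisensteinSum_nineteen (τ : ℍ) {q : ℂ} (hq : q = nome τ) :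
    eisensteinSum 19 τ = qPochs [q ^ 8, q ^ 11, q ^ 9, q ^ 10, q ^ 19, q ^ 19] (q ^ 19) /
      qPochs [q ^ 3, q ^ 16, q ^ 4, q ^ 15, q ^ 5, q ^ 14] (q ^ 19) := by
  have hq0 : q ≠ 0 := hq ▸ nome_ne_zero τ
  have hq1 : ‖q‖ < 1 := hq ▸ norm_nome_lt_one τ
  -- Only θ_12 = θ_7 cancels, hence the longer quotient for 19.
  have hr : HasUnitOddDefect ((3 : ℕ) : ZMod 19) (4 : ℕ) (5 : ℕ) := by
    unfold HasUnitOddDefect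
    decide
  have : Fact (Nat.Prime 19) := ⟨by norm_num⟩
  have h := eisensteinSum_mul_theta (p := 19) (a := 3) (b := 4) (c := 5) (by norm_num)
    (by norm_num) (by norm_num) (by norm_num) (by norm_num) hr τ hq
  norm_num only at h
  have hn (k : ℕ) (hk : 0 < k) (hkp : k < 19) := theta_pow_ne_zero hk hkp hq0 hq1
  have n3 := hn 3 (by norm_num) (by norm_num)
  have n4 := hn 4 (by norm_num) (by norm_num)
  have n5 := hn 5 (by norm_num) (by norm_num)
  have n7 := hn 7 (by norm_num) (by norm_num)
  rw [theta_pow_sub (p := 19) (k := 12) (l := 7) (by norm_num) hq0] at h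
  have e1 : qPochs [q ^ 3, q ^ 16, q ^ 4, q ^ 15, q ^ 5, q ^ 14] (q ^ 19) =
      theta (q ^ 19) (q ^ 3) * theta (q ^ 19) (q ^ 4) * theta (q ^ 19) (q ^ 5) := by
    simp [qPochs, theta_pow (p := 19) (k := 3) (by norm_num) hq0,
      theta_pow (p := 19) (k := 4) (by norm_num) hq0,
      theta_pow (p := 19) (k := 5) (by norm_num) hq0]
    ring
  have e2 : qPochs [q ^ 8, q ^ 11, q ^ 9, q ^ 10, q ^ 19, q ^ 19] (q ^ 19) =
      theta (q ^ 19) (q ^ 8) * theta (q ^ 19) (q ^ 9) * qPoch (q ^ 19) (q ^ 19) ^ 2 := by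
    simp [qPochs, theta_pow (p := 19) (k := 8) (by norm_num) hq0,
      theta_pow (p := 19) (k := 9) (by norm_num) hq0]
    ring
  rw [e1, e2, eq_div_iff (mul_ne_zero (mul_ne_zero n3 n4) n5)]
  refine mul_right_cancel₀ n7 ?_
  linear_combination h

end WeightOneEisenstein

end

theorem mainTheorem6 (τ : UpperHalfPlane) (q : ℂ)
    (hq : q = WeightOneEisenstein.nome τ) :
    WeightOneEisenstein.eisensteinSum 5 τ =
        WeightOneEisenstein.qPoch q q ^ 2 /
          WeightOneEisenstein.qPochs [q, q ^ 4] (q ^ 5) ^ 5 ∧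
    WeightOneEisenstein.eisensteinSum 7 τ =
        WeightOneEisenstein.qPochs [q ^ 3, q ^ 4, q ^ 7, q ^ 7] (q ^ 7) /
          WeightOneEisenstein.qPochs [q, q ^ 6] (q ^ 7) ^ 2 ∧
    WeightOneEisenstein.eisensteinSum 11 τ =
        WeightOneEisenstein.qPochs [q ^ 4, q ^ 7, q ^ 11, q ^ 11] (q ^ 11) /
          WeightOneEisenstein.qPochs [q, q ^ 10, q ^ 2, q ^ 9] (q ^ 11) ∧
    WeightOneEisenstein.eisensteinSum 13 τ =
        WeightOneEisenstein.qPochs [q ^ 6, q ^ 7, q ^ 13, q ^ 13] (q ^ 13) /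
          WeightOneEisenstein.qPochs [q, q ^ 12, q ^ 3, q ^ 10] (q ^ 13) ∧
    WeightOneEisenstein.eisensteinSum 17 τ =
        WeightOneEisenstein.qPochs [q ^ 8, q ^ 9, q ^ 17, q ^ 17] (q ^ 17) /
          WeightOneEisenstein.qPochs [q ^ 2, q ^ 15, q ^ 3, q ^ 14] (q ^ 17) ∧
    WeightOneEisenstein.eisensteinSum 19 τ =
        WeightOneEisenstein.qPochs
            [q ^ 8, q ^ 11, q ^ 9, q ^ 10, q ^ 19, q ^ 19] (q ^ 19) /
          WeightOneEisenstein.qPochs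
            [q ^ 3, q ^ 16, q ^ 4, q ^ 15, q ^ 5, q ^ 14] (q ^ 19) := by
  exact ⟨WeightOneEisenstein.eisensteinSum_five τ hq,
    WeightOneEisenstein.eisensteinSum_seven τ hq,
    WeightOneEisenstein.eisensteinSum_eleven τ hq,
    WeightOneEisenstein.eisensteinSum_thirteen τ hq,
    WeightOneEisenstein.eisensteinSum_seventeen τ hq,
    WeightOneEisenstein.eisensteinSum_nineteen τ hq⟩
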